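/- **Setting.** A polynomial $p\in\mathbb{R}[v_1,\dots,v_n]$ is *concave quadratic (CQ)* if $p=v^{T}Av+2\alpha^{T}v+a$ with $A$ real symmetric and negative semidefinite. Let $$\varphi=\bigwedge_{i\le r_1} f_i\ge 0\wedge\bigwedge_{j\le s_1} g_j>0,\qquad \psi=\bigwedge_{r_1<i\le r} f_i\ge 0\wedge\bigwedge_{s_1<j\le s} g_j>0 .$$ $\mathrm{Var}(\cdot)$ is the set of variables that occur; $\mathbf{x}$ denotes the variables common to $\varphi$ and $\psi$, $\mathbf{y}$ those only in $\varphi$, $\mathbf{z}$ those only in $\psi$. A quantifier-free polynomial formula $I$ is a *(reverse) interpolant* of $\varphi,\psi$ if $\varphi\models I$, $I\wedge\psi\models\bot$ and $\mathrm{Var}(I)\subseteq \mathrm{Var}(\varphi)\cap \mathrm{Var}(\psi)$. *NSOSC* holds for $\varphi,\psi$ if there are no $\delta_1,\dots,\delta_r\ge0$ such that $-\sum_i\delta_if_i$ is a nonzero sum of squares (SOS) of polynomials. **The algorithm IGFQC$(\varphi,\psi)$.** (Feasibility problems are solved exactly, with arbitrary choice among the solutions.) 1. If $\mathrm{Var}(\varphi)\subseteq\mathrm{Var}(\psi)$,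 return $\varphi$. 2. Otherwise, if NSOSC holds (procedure IGFCH): find $\lambda_i\ge0$, $\eta_0,\dots,\eta_s\ge0$ and SOS polynomials $h_1\in\mathbb{R}[\mathbf{x},\mathbf{y}]$, $h_2\in\mathbb{R}[\mathbf{x},\mathbf{z}]$ with $\sum_i\lambda_if_i+\sum_{j\ge1}\eta_jg_j+\eta_0+h_1+h_2\equiv0$ and $\sum_{j\ge0}\eta_j=1$. Let $p=\sum_{i\le r_1}\lambda_if_i+\sum_{1\le j\le s_1}\eta_jg_j+\eta_0+h_1$. Return $p>0$ if $\sum_{j=0}^{s_1}\eta_j>0$, and $p\ge0$ otherwise. 3. Otherwise find $\delta_i\ge 0$ and a nonzero SOS $h$ with $\sum_i\delta_if_i+h\equiv0$. Write $h=h_1+h_2$, where, with constants $a_v\ge0$ and $a_0\ge0$, $$h_1=\sum_{v\in\mathbf{y}}a_v(v-l_v)^2+\tfrac12\sum_{v\in\mathbf{x}}a_v(v-l_v)^2+\tfrac12a_0,\qquad h_2=\sum_{v\in\mathbf{z}}a_v(v-l_v)^2+\tfrac12\sum_{v\in\mathbf{x}}a_v(v-l_v)^2+\tfrac12a_0,$$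 and each $l_v$ is an affine polynomial: for $v\in\mathbf{y}$ in the variables $\mathbf{x}$ and the later variables of $\mathbf{y}$, for $v\in\mathbf{z}$ in $\mathbf{x}$ and the later variables of $\mathbf{z}$, for $v\in\mathbf{x}$ in the later variables of $\mathbf{x}$. Put $f=\sum_{i\le r_1}\delta_if_i+h_1$. If $a_0>0$, let $\varphi'=\psi'=(0>0)$. If $a_0=0$, solve the triangular linear system $\{v=l_v: a_v>0\}$ given by $h_1=h_2=0$ for the variables $v$ with $a_v>0$, and obtain $\varphi',\psi'$ by substituting the solution for these variables in $\varphi,\psi$. Compute $I'=\mathrm{IGFQC}(\varphi',\psi')$ recursively and return $(f>0)\vee(f\ge0\wedge I')$. **Theorem (soundness and completeness of IGFQC).** Let $\varphi,\psi$ be conjunctions as above with all $f_i,g_j$ CQ and $\varphi\wedge\psi\models\bot$ (NSOSC is not assumed). Then: - *Soundness.* Every output of IGFQC$(\varphi,\psi)$ is an interpolant of $\varphi$ and $\psi$. - *Completeness.* IGFQC$(\varphi,\psi)$ has an output, and no run gets stuck before producing one: every solution, splitting or elimination it asks for exists. - *Termination.* Every run is finite. It makes at most $\#(\mathrm{Var}(\varphi)\cup\mathrm{Var}(\psi))$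 recursive calls, and hence at most $2\,\#(\mathrm{Var}(\varphi)\cup\mathrm{Var}(\psi))+1$ steps (entering a recursive call, returning from a base case, and combining $I'$ with $f$ each count as one step). - *Recursive calls.* Whenever, in a run, a call on $(\varphi_1,\psi_1)$ makes a recursive call on $(\varphi_2,\psi_2)$ with the polynomial $f$ of step 3, NSOSC fails for $\varphi_1,\psi_1$; $f$ contains only variables common to $\varphi_1$ and $\psi_1$; $\varphi_1\models f\ge0$ and $\psi_1\models -f\ge0$; $\varphi_2,\psi_2$ again consist of CQ inequalities with $\varphi_2\wedge\psi_2\models\bot$; and $\#(\mathrm{Var}(\varphi_2)\cup\mathrm{Var}(\psi_2))<\#(\mathrm{Var}(\varphi_1)\cup\mathrm{Var}(\psi_1))$. -/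

import Mathlib

open MvPolynomial

/-! ### Quantifier-free polynomial formulas and interpolants -/

/-- Quantifier-free formulas over the reals in the variables `x_0, …, x_{n-1}`. -/
inductive PolyFormula (n : ℕ) : Type
  | verum : PolyFormula n
  | falsum : PolyFormula n
  | ge : MvPolynomial (Fin n) ℝ → PolyFormula n
  | gt : MvPolynomial (Fin n) ℝ → PolyFormula n
  | and : PolyFormula n → PolyFormula n → PolyFormula n
  | or : PolyFormula n → PolyFormula n → PolyFormula n
  | neg : PolyFormula n → PolyFormula n

namespace PolyFormula

variable {n : ℕ}

/-- Truth of a formula at a point; `ge p` is the atom `p ≥ 0` and `gt p` the atom `p > 0`. -/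
def Holds : PolyFormula n → (Fin n → ℝ) → Prop
  | verum, _ => True
  | falsum, _ => False
  | ge p, x => 0 ≤ eval x p
  | gt p, x => 0 < eval x p
  | and A B, x => A.Holds x ∧ B.Holds x
  | or A B, x => A.Holds x ∨ B.Holds x
  | neg A, x => ¬ A.Holds x

/-- The variables occurring in a formula. -/
noncomputable def vars : PolyFormula n → Finset (Fin n)
  | verum => ∅
  | falsum => ∅
  | ge p => p.vars
  | gt p => p.vars
  | and A B => A.vars ∪ B.vars
  | or A B => A.vars ∪ B.vars
  | neg A => A.vars

/-- `A ⊨ B`. -/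
def Entails (A B : PolyFormula n) : Prop :=
  ∀ x : Fin n → ℝ, A.Holds x → B.Holds x

/-- `I` is a (reverse) interpolant of `A` and `B`. -/
def IsInterpolant (I A B : PolyFormula n) : Prop :=
  A.Entails I ∧ (I.and B).Entails falsum ∧ I.vars ⊆ A.vars ∩ B.vars

/-- The conjunction of a finite list of formulas. -/
def conj : List (PolyFormula n) → PolyFormula n
  | [] => verum
  | A :: L => A.and (conj L)

end PolyFormula

/-! ### Conjunctions of concave quadratic inequalities -/

/-- Concave quadratic polynomials: `f = xᵀ A x + 2 αᵀ x + a` with `A` symmetric and `A ⪯ 0`. -/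
def IsConcaveQuadratic {n : ℕ} (p : MvPolynomial (Fin n) ℝ) : Prop :=
  ∃ (A : Matrix (Fin n) (Fin n) ℝ) (α : Fin n → ℝ) (a : ℝ),
    A.IsSymm ∧ (-A).PosSemidef ∧
    p = ∑ i, ∑ j, C (A i j) * X i * X j + 2 * ∑ i, C (α i) * X i + C a

/-- A conjunction `f_1 ≥ 0 ∧ … ∧ f_r ≥ 0 ∧ g_1 > 0 ∧ … ∧ g_s > 0`. -/
structure IneqSystem (n : ℕ) where
  r : ℕ
  s : ℕ
  f : Fin r → MvPolynomial (Fin n) ℝ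
  g : Fin s → MvPolynomial (Fin n) ℝ

namespace IneqSystem

variable {n : ℕ}

/-- The conjunction as a formula. -/
def toFormula (φ : IneqSystem n) : PolyFormula n :=
  (PolyFormula.conj (List.ofFn fun i => .ge (φ.f i))).and
    (PolyFormula.conj (List.ofFn fun j => .gt (φ.g j)))

/-- `Var(φ)`. -/
noncomputable def vars (φ : IneqSystem n) : Finset (Fin n) := φ.toFormula.vars

/-- All polynomials of the system are concave quadratic. -/
def IsCQ (φ : IneqSystem n) : Prop :=
  (∀ i, IsConcaveQuadratic (φ.f i)) ∧ ∀ j, IsConcaveQuadratic (φ.g j)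

/-- `φ ∧ ψ ⊨ ⊥`. -/
def Contradictory (φ ψ : IneqSystem n) : Prop :=
  (φ.toFormula.and ψ.toFormula).Entails .falsum

/-- The system `0 > 0`. -/
noncomputable def absurd (n : ℕ) : IneqSystem n where
  r := 0
  s := 1
  f := fun _ => 0
  g := fun _ => 0

/-- Substitution of `σ v` for every variable `v` in all polynomials of the system. -/
noncomputable def subst (σ : Fin n → MvPolynomial (Fin n) ℝ) (φ : IneqSystem n) :
    IneqSystem n where
  r := φ.r
  s := φ.s
  f := fun i => bind₁ σ (φ.f i)
  g := fun j => bind₁ σ (φ.g j)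

/-- `∑ δ_i f_i` over the nonstrict inequalities. -/
noncomputable def combF (φ : IneqSystem n) (δ : Fin φ.r → ℝ) : MvPolynomial (Fin n) ℝ :=
  ∑ i, C (δ i) * φ.f i

/-- `∑ η_j g_j` over the strict inequalities. -/
noncomputable def combG (φ : IneqSystem n) (η : Fin φ.s → ℝ) : MvPolynomial (Fin n) ℝ :=
  ∑ j, C (η j) * φ.g j

end IneqSystem

/-- The condition NSOSC: no nonpositive combination `-∑ δ_i f_i` (`δ_i ≥ 0`) of the polynomials in
the nonstrict inequalities of `φ` and `ψ` is a nonzero sum of squares. -/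
def NSOSC {n : ℕ} (φ ψ : IneqSystem n) : Prop :=
  ¬ ∃ (δ : Fin φ.r → ℝ) (δ' : Fin ψ.r → ℝ),
    (∀ i, 0 ≤ δ i) ∧ (∀ i, 0 ≤ δ' i) ∧
    IsSumSq (-(φ.combF δ + ψ.combF δ')) ∧ -(φ.combF δ + ψ.combF δ') ≠ 0

/-! ### The base case IGFCH -/

/-- `IGFCHReturns φ ψ I`: for some solution of the semidefinite feasibility problem solved by IGFCH
on input `φ, ψ`, the procedure returns `I`. -/
inductive IGFCHReturns {n : ℕ} (φ ψ : IneqSystem n) : PolyFormula n → Prop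
  | intro (lam : Fin φ.r → ℝ) (lam' : Fin ψ.r → ℝ) (η₀ : ℝ) (η : Fin φ.s → ℝ) (η' : Fin ψ.s → ℝ)
      (h₁ h₂ p : MvPolynomial (Fin n) ℝ) (I : PolyFormula n)
      (lam_nonneg : ∀ i, 0 ≤ lam i) (lam'_nonneg : ∀ i, 0 ≤ lam' i)
      (η₀_nonneg : 0 ≤ η₀) (η_nonneg : ∀ j, 0 ≤ η j) (η'_nonneg : ∀ j, 0 ≤ η' j)
      (sos₁ : IsSumSq h₁) (sos₂ : IsSumSq h₂)
      (vars₁ : h₁.vars ⊆ φ.vars) (vars₂ : h₂.vars ⊆ ψ.vars)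
      (identity : φ.combF lam + ψ.combF lam' + φ.combG η + ψ.combG η' + C η₀ + h₁ + h₂ = 0)
      (normalized : η₀ + ∑ j, η j + ∑ j, η' j = 1)
      (hp : p = φ.combF lam + φ.combG η + C η₀ + h₁)
      (strict : 0 < η₀ + ∑ j, η j → I = .gt p)
      (nonstrict : ¬ 0 < η₀ + ∑ j, η j → I = .ge p) :
      IGFCHReturns φ ψ I

/-! ### The recursive case of IGFQC -/

section Recursion

variable {n : ℕ}

/-- The common variables `𝐱`. -/
noncomputable def commonVars (φ ψ : IneqSystem n) : Finset (Fin n) := φ.vars ∩ ψ.vars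

/-- The variables occurring in the first system only: `𝐲` for `(φ, ψ)`, `𝐳` for `(ψ, φ)`. -/
noncomputable def localVars (φ ψ : IneqSystem n) : Finset (Fin n) := φ.vars \ ψ.vars

/-- `∑_{v ∈ S} a_v (v - l_v)²`. -/
noncomputable def squareSum (S : Finset (Fin n)) (a : Fin n → ℝ)
    (l : Fin n → MvPolynomial (Fin n) ℝ) : MvPolynomial (Fin n) ℝ :=
  ∑ v ∈ S, C (a v) * (X v - l v) ^ 2

/-- The polynomial `h₁(𝐱, 𝐲)` for `(φ, ψ)`, and `h₂(𝐱, 𝐳)` for `(ψ, φ)`: the squares belonging to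
the local variables, half of those belonging to the common variables, and half of the constant. -/
noncomputable def squarePart (φ ψ : IneqSystem n) (a : Fin n → ℝ) (a₀ : ℝ)
    (l : Fin n → MvPolynomial (Fin n) ℝ) : MvPolynomial (Fin n) ℝ :=
  squareSum (localVars φ ψ) a l + C (1 / 2) * squareSum (commonVars φ ψ) a l + C (a₀ / 2)

/-- `a`, `a₀`, `l` split `h` as `h₁ + h₂`, by completing squares triangularly: `l_v` is affine; for a
local variable `v` it involves only common variables and later local variables on the same side,
for a common variable `v` only later common variables. -/
structure IsSplitting (φ ψ : IneqSystem n) (h : MvPolynomial (Fin n) ℝ)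
    (a : Fin n → ℝ) (a₀ : ℝ) (l : Fin n → MvPolynomial (Fin n) ℝ) : Prop where
  a_nonneg : ∀ v ∈ φ.vars ∪ ψ.vars, 0 ≤ a v
  a₀_nonneg : 0 ≤ a₀
  affine : ∀ v ∈ φ.vars ∪ ψ.vars, (l v).totalDegree ≤ 1
  vars_left : ∀ v ∈ localVars φ ψ,
    (l v).vars ⊆ commonVars φ ψ ∪ (localVars φ ψ).filter (v < ·)
  vars_right : ∀ v ∈ localVars ψ φ,
    (l v).vars ⊆ commonVars φ ψ ∪ (localVars ψ φ).filter (v < ·)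
  vars_common : ∀ v ∈ commonVars φ ψ, (l v).vars ⊆ (commonVars φ ψ).filter (v < ·)
  eq_add : h = squarePart φ ψ a a₀ l + squarePart ψ φ a a₀ l

/-- The variables solved for by `h₁ = h₂ = 0` (when the constant is `0`): those whose square has a
positive coefficient. -/
noncomputable def eliminatedVars (φ ψ : IneqSystem n) (a : Fin n → ℝ) : Finset (Fin n) :=
  (φ.vars ∪ ψ.vars).filter (0 < a ·)

/-- `σ` is the solution of the linear equations `v = l_v`, `v` eliminated, that come from
`h₁ = h₂ = 0`: eliminated variables are expressed affinely through the remaining ones (common ones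
through common ones, local ones through common and local ones on the same side), and all other
variables are left alone. -/
structure IsElimination (φ ψ : IneqSystem n) (a : Fin n → ℝ)
    (l σ : Fin n → MvPolynomial (Fin n) ℝ) : Prop where
  fixed : ∀ v ∉ eliminatedVars φ ψ a, σ v = X v
  affine : ∀ v, (σ v).totalDegree ≤ 1
  vars_left : ∀ v ∈ eliminatedVars φ ψ a, v ∈ φ.vars →
    (σ v).vars ⊆ φ.vars \ eliminatedVars φ ψ a
  vars_right : ∀ v ∈ eliminatedVars φ ψ a, v ∈ ψ.vars →
    (σ v).vars ⊆ ψ.vars \ eliminatedVars φ ψ a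
  solves : ∀ v ∈ eliminatedVars φ ψ a, σ v = bind₁ σ (l v)

/-- `RecursiveCall φ ψ f φ' ψ'`: when a nonzero sum of squares `h = -∑ δ_i f_i` is found for
`φ, ψ`, the algorithm forms `f = ∑_{i ≤ r₁} δ_i f_i + h₁` and calls itself on `φ', ψ'`. -/
inductive RecursiveCall (φ ψ : IneqSystem n) :
    MvPolynomial (Fin n) ℝ → IneqSystem n → IneqSystem n → Prop
  | inconsistent (δ : Fin φ.r → ℝ) (δ' : Fin ψ.r → ℝ) (h : MvPolynomial (Fin n) ℝ)
      (a : Fin n → ℝ) (a₀ : ℝ) (l : Fin n → MvPolynomial (Fin n) ℝ)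
      (δ_nonneg : ∀ i, 0 ≤ δ i) (δ'_nonneg : ∀ i, 0 ≤ δ' i)
      (identity : φ.combF δ + ψ.combF δ' + h = 0) (sos : IsSumSq h) (ne_zero : h ≠ 0)
      (splitting : IsSplitting φ ψ h a a₀ l) (const_pos : 0 < a₀) :
      RecursiveCall φ ψ (φ.combF δ + squarePart φ ψ a a₀ l)
        (IneqSystem.absurd n) (IneqSystem.absurd n)
  | eliminate (δ : Fin φ.r → ℝ) (δ' : Fin ψ.r → ℝ) (h : MvPolynomial (Fin n) ℝ)
      (a : Fin n → ℝ) (a₀ : ℝ) (l σ : Fin n → MvPolynomial (Fin n) ℝ)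
      (δ_nonneg : ∀ i, 0 ≤ δ i) (δ'_nonneg : ∀ i, 0 ≤ δ' i)
      (identity : φ.combF δ + ψ.combF δ' + h = 0) (sos : IsSumSq h) (ne_zero : h ≠ 0)
      (splitting : IsSplitting φ ψ h a a₀ l) (const_zero : a₀ = 0)
      (elimination : IsElimination φ ψ a l σ) :
      RecursiveCall φ ψ (φ.combF δ + squarePart φ ψ a a₀ l) (φ.subst σ) (ψ.subst σ)

end Recursion

/-! ### The algorithm IGFQC as a transition system -/

/-- Configurations of IGFQC: about to process the call `IGFQC(φ, ψ)`, or having just obtained the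
result `I` of a call. The list is the stack of pending calls, each recorded by its `f`. -/
inductive IGFQCConfig (n : ℕ) : Type
  | call : IneqSystem n → IneqSystem n → List (MvPolynomial (Fin n) ℝ) → IGFQCConfig n
  | ret : PolyFormula n → List (MvPolynomial (Fin n) ℝ) → IGFQCConfig n

/-- One step of IGFQC. The steps are nondeterministic exactly in the choice of the solutions of the
feasibility problems and of the splitting of `h`. -/
inductive IGFQCStep {n : ℕ} : IGFQCConfig n → IGFQCConfig n → Prop
  | varSubset (φ ψ : IneqSystem n) (K : List (MvPolynomial (Fin n) ℝ))
      (hv : φ.vars ⊆ ψ.vars) :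
      IGFQCStep (.call φ ψ K) (.ret φ.toFormula K)
  | base (φ ψ : IneqSystem n) (K : List (MvPolynomial (Fin n) ℝ)) (I : PolyFormula n)
      (hv : ¬ φ.vars ⊆ ψ.vars) (hN : NSOSC φ ψ) (hI : IGFCHReturns φ ψ I) :
      IGFQCStep (.call φ ψ K) (.ret I K)
  | recurse (φ ψ φ' ψ' : IneqSystem n) (f : MvPolynomial (Fin n) ℝ)
      (K : List (MvPolynomial (Fin n) ℝ))
      (hv : ¬ φ.vars ⊆ ψ.vars) (hN : ¬ NSOSC φ ψ) (hc : RecursiveCall φ ψ f φ' ψ') :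
      IGFQCStep (.call φ ψ K) (.call φ' ψ' (f :: K))
  | combine (I' : PolyFormula n) (f : MvPolynomial (Fin n) ℝ)
      (K : List (MvPolynomial (Fin n) ℝ)) :
      IGFQCStep (.ret I' (f :: K)) (.ret (.or (.gt f) (.and (.ge f) I')) K)

/-- `c` occurs in some run of IGFQC on input `φ, ψ`. -/
def IGFQCReaches {n : ℕ} (φ ψ : IneqSystem n) (c : IGFQCConfig n) : Prop :=
  Relation.ReflTransGen IGFQCStep (.call φ ψ []) c

/-- Some run of IGFQC on input `φ, ψ` ends with output `I`. -/
def IGFQCReturns {n : ℕ} (φ ψ : IneqSystem n) (I : PolyFormula n) : Prop :=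
  IGFQCReaches φ ψ (.ret I [])

/-! A concave quadratic polynomial is a symmetric matrix in the homogeneous coordinates (1, v) whose
form is nonpositive where the first coordinate vanishes. In this picture a nonnegative quadratic
polynomial is a positive semidefinite matrix, and three facts carry the theorem.

Splitting (`IsPSDForm.exists_squares`, `exists_isSplitting_of_nonneg`). No single inequality couples
a 𝐲-variable with a 𝐳-variable. Eliminating local variables before common ones never creates such a
coupling, so completing squares separates the sum into a part over φ and a part over ψ.

Base case (`exists_IGFCHReturns`). NSOSC makes the cone generated by the f_i and the semidefinite
matrices closed. Separation then gives either the certificate or a functional that is nonnegative on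
this cone and positive on the g_j and on 1. By Jensen's inequality for concave quadratics, the
barycentre of such a functional would be a real solution of φ ∧ ψ (`exists_barycentre`), so the
certificate exists.

Recursive case (`RecursiveCall.spec`). The identity presents f as a φ-expression and -f as the
mirror ψ-expression. Hence f has only common variables, is nonnegative on φ and nonpositive on ψ.
Where f = 0 all squares vanish, so solutions of φ or of ψ are unchanged by the substitution, and the
inner interpolant decides there. Since h ≠ 0, either its constant is positive or some variable
disappears.

An invariant of configurations together with a decreasing potential turns these local facts into
statements about all runs. -/

/-! ### Closedness of cones and a theorem of the alternative -/

section Cones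

variable {V W : Type*} [NormedAddCommGroup V] [NormedSpace ℝ V]
  [NormedAddCommGroup W] [NormedSpace ℝ W]

/-- A continuous linear image of a closed cone meeting the kernel only in `0` is closed. -/
theorem isClosed_image_cone [FiniteDimensional ℝ W] (T : W →L[ℝ] V) {K : Set W}
    (hK : IsClosed K) (hsmul : ∀ c : ℝ, 0 ≤ c → ∀ x ∈ K, c • x ∈ K)
    (hker : ∀ x ∈ K, T x = 0 → x = 0) : IsClosed (T '' K) := by
  have : ProperSpace W := FiniteDimensional.proper ℝ W
  have hS : IsCompact (K ∩ Metric.sphere 0 1) := (isCompact_sphere (0 : W) 1).inter_left hK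
  -- The minimum of ‖T x‖ on the compact set of unit vectors of `K` is positive, because `K` meets
  -- the kernel only in 0. This bound keeps preimages of a convergent sequence in a ball.
  obtain ⟨c, hc, hb⟩ : ∃ c : ℝ, 0 < c ∧ ∀ x ∈ K, c * ‖x‖ ≤ ‖T x‖ := by
    rcases (K ∩ Metric.sphere (0 : W) 1).eq_empty_or_nonempty with he | hne
    · refine ⟨1, one_pos, fun x hx => ?_⟩
      rcases eq_or_ne x 0 with rfl | h0
      · simp
      · have : ‖x‖⁻¹ • x ∈ K ∩ Metric.sphere 0 1 := by
          refine ⟨hsmul _ (by positivity) _ hx, ?_⟩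
          simp [norm_smul, h0]
        simp [he] at this
    · obtain ⟨x₀, hx₀, hmin⟩ := hS.exists_isMinOn hne (f := fun x => ‖T x‖) (by fun_prop)
      have h1 : ‖x₀‖ = 1 := by simpa using hx₀.2
      refine ⟨‖T x₀‖, ?_, fun x hx => ?_⟩
      · rw [norm_pos_iff]
        intro h
        rw [hker _ hx₀.1 h] at h1
        simp at h1
      · rcases eq_or_ne x 0 with rfl | h0
        · simp
        · have hm : ‖x‖⁻¹ • x ∈ K ∩ Metric.sphere 0 1 := by
            refine ⟨hsmul _ (by positivity) _ hx, ?_⟩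
            simp [norm_smul, h0]
          have h2 : ‖T x₀‖ ≤ ‖T (‖x‖⁻¹ • x)‖ := hmin hm
          have hp : 0 < ‖x‖ := norm_pos_iff.2 h0
          rw [map_smul, norm_smul, norm_inv, norm_norm, inv_mul_eq_div, le_div_iff₀ hp] at h2
          exact h2
  refine IsSeqClosed.isClosed fun y v hy hv => ?_
  choose x hxK hxy using hy
  obtain ⟨R, hR⟩ := hv.norm.bddAbove_range
  have hbd : ∀ k, x k ∈ Metric.closedBall (0 : W) (R / c) := fun k => by
    have h1 : ‖y k‖ ≤ R := hR ⟨k, rfl⟩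
    have h2 := hb _ (hxK k)
    rw [hxy] at h2
    rw [mem_closedBall_zero_iff, le_div_iff₀ hc]
    linarith
  obtain ⟨z, -, s, hs, hz⟩ := (isCompact_closedBall (0 : W) (R / c)).tendsto_subseq hbd
  refine ⟨z, hK.mem_of_tendsto hz (Filter.Eventually.of_forall fun k => hxK _), ?_⟩
  refine tendsto_nhds_unique ((T.continuous.tendsto z).comp hz) ?_
  refine (hv.comp hs.tendsto_atTop).congr fun k => ?_
  simp [hxy]

/-- The sum of a finitely generated cone and a closed cone `P` is closed if the elements of `P`
whose opposites lie in the finitely generated cone vanish. -/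
theorem isClosed_finite_cone_add [FiniteDimensional ℝ V] {ι : Type*} [Fintype ι] (f : ι → V)
    {P : Set V} (hP : IsClosed P) (hsmul : ∀ c : ℝ, 0 ≤ c → ∀ x ∈ P, c • x ∈ P)
    (hf : ∀ (δ : ι → ℝ), (∀ i, 0 ≤ δ i) → ∀ p ∈ P, ∑ i, δ i • f i + p = 0 → p = 0) :
    IsClosed {v | ∃ (δ : ι → ℝ) (p : V), (∀ i, 0 ≤ δ i) ∧ p ∈ P ∧ v = ∑ i, δ i • f i + p} := by
  classical
  let T : ((ι → ℝ) × V) →L[ℝ] V :=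
    LinearMap.toContinuousLinearMap
      ((Fintype.linearCombination ℝ f).coprod LinearMap.id)
  have hT : ∀ δ p, T (δ, p) = ∑ i, δ i • f i + p := fun δ p => by
    simp [T, Fintype.linearCombination_apply]
  let K : Finset ι → Set ((ι → ℝ) × V) := fun I =>
    {x | (∀ i, 0 ≤ x.1 i) ∧ (∀ i, i ∉ I → x.1 i = 0) ∧ x.2 ∈ P}
  have hK : ∀ I, IsClosed (K I) := fun I => by
    have h1 : IsClosed {x : (ι → ℝ) × V | ∀ i, 0 ≤ x.1 i} := by
      simp only [Set.ofPred_forall]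
      exact isClosed_iInter fun i => isClosed_le continuous_const (by fun_prop)
    have h2 : IsClosed {x : (ι → ℝ) × V | ∀ i, i ∉ I → x.1 i = 0} := by
      simp only [Set.ofPred_forall]
      exact isClosed_iInter fun i => isClosed_iInter fun _ => isClosed_eq (by fun_prop)
        continuous_const
    exact h1.inter (h2.inter (hP.preimage continuous_snd))
  -- Induction on the allowed support `I`: either `T` has no kernel in `K I`, or the image is a
  -- finite union of images with smaller support.
  have key : ∀ I, IsClosed (T '' K I) := by
    intro I
    induction I using Finset.strongInduction with
    | H I ih =>
      by_cases htriv : ∀ x ∈ K I, T x = 0 → x = 0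
      · refine isClosed_image_cone T (hK I) ?_ htriv
        rintro c hc ⟨δ, p⟩ ⟨h1, h2, h3⟩
        refine ⟨fun i => mul_nonneg hc (h1 i), fun i hi => ?_, hsmul c hc p h3⟩
        simp only at h2
        simp only [Prod.smul_mk, Pi.smul_apply, smul_eq_mul]
        rw [h2 i hi, mul_zero]
      · push Not at htriv
        obtain ⟨⟨δ, p⟩, ⟨h1, h2, h3⟩, h0, hne⟩ := htriv
        simp only at h1 h2 h3
        rw [hT] at h0
        have hp : p = 0 := hf δ h1 p h3 h0
        subst hp
        rw [add_zero] at h0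
        have hJ : (I.filter fun i => 0 < δ i).Nonempty := by
          by_contra hemp
          rw [Finset.not_nonempty_iff_eq_empty, Finset.filter_eq_empty_iff] at hemp
          apply hne
          ext i
          · by_cases hi : i ∈ I
            · exact le_antisymm (not_lt.1 (hemp hi)) (h1 i)
            · exact h2 i hi
          · rfl
        -- Carathéodory's argument. By `hf` the kernel element has no `P`-component, so it is a
        -- relation ∑ δ_i f_i = 0 that can be subtracted without leaving `P`.
        have hU : T '' K I = ⋃ i ∈ I, T '' K (I.erase i) := by
          apply Set.Subset.antisymm
          · rintro _ ⟨⟨μ, q⟩, ⟨g1, g2, g3⟩, rfl⟩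
            simp only at g1 g2 g3
            -- The smallest ratio is the largest multiple of δ that can be subtracted with all
            -- coefficients staying nonnegative; it kills the coefficient at `i₀`.
            obtain ⟨i₀, hi₀, hmin⟩ := Finset.exists_min_image _ (fun i => μ i / δ i) hJ
            rw [Finset.mem_filter] at hi₀
            simp only [Set.mem_iUnion]
            refine ⟨i₀, hi₀.1, (fun i => μ i - μ i₀ / δ i₀ * δ i, q), ⟨?_, ?_, g3⟩, ?_⟩
            · intro i
              simp only [sub_nonneg]
              rcases (h1 i).eq_or_lt with hz | hpos
              · rw [← hz, mul_zero]; exact g1 i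
              · by_cases hi : i ∈ I
                · have := hmin i (by simp [hi, hpos])
                  rwa [le_div_iff₀ hpos] at this
                · rw [h2 i hi, mul_zero]; exact g1 i
            · intro i hi
              by_cases h : i = i₀
              · subst h
                simp [hi₀.2.ne']
              · have hi' : i ∉ I := fun hI => hi (Finset.mem_erase.2 ⟨h, hI⟩)
                simp [g2 i hi', h2 i hi']
            · rw [hT, hT]
              simp only [sub_smul, mul_smul, Finset.sum_sub_distrib, ← Finset.smul_sum, h0]
              simp
          · simp only [Set.iUnion_subset_iff]
            rintro i hi _ ⟨⟨μ, q⟩, ⟨g1, g2, g3⟩, rfl⟩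
            exact ⟨(μ, q), ⟨g1, fun j hj => g2 j fun h => hj (Finset.mem_of_mem_erase h), g3⟩, rfl⟩
        rw [hU]
        exact I.finite_toSet.isClosed_biUnion fun i hi => ih _ (Finset.erase_ssubset hi)
  convert key Finset.univ using 1
  ext v
  constructor
  · rintro ⟨δ, p, h1, h2, rfl⟩
    exact ⟨(δ, p), ⟨h1, by simp, h2⟩, hT _ _⟩
  · rintro ⟨⟨δ, p⟩, ⟨h1, -, h2⟩, rfl⟩
    exact ⟨δ, p, h1, h2, hT _ _⟩

/-- Theorem of the alternative for a finitely generated cone `cone f`, a closed convex cone `P`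
and finitely many strict conditions `g`. -/
theorem exists_combination_or_functional [FiniteDimensional ℝ V] {ι κ : Type*} [Fintype ι]
    [Fintype κ] (f : ι → V) (g : κ → V) {P : Set V} (hP : IsClosed P) (h0 : (0 : V) ∈ P)
    (hadd : ∀ x ∈ P, ∀ y ∈ P, x + y ∈ P) (hsmul : ∀ c : ℝ, 0 ≤ c → ∀ x ∈ P, c • x ∈ P)
    (hf : ∀ (δ : ι → ℝ), (∀ i, 0 ≤ δ i) → ∀ p ∈ P, ∑ i, δ i • f i + p = 0 → p = 0) :
    (∃ (lam : ι → ℝ) (η : κ → ℝ), (∀ i, 0 ≤ lam i) ∧ (∀ j, 0 ≤ η j) ∧ ∑ j, η j = 1 ∧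
      -(∑ i, lam i • f i + ∑ j, η j • g j) ∈ P) ∨
    ∃ L : V →L[ℝ] ℝ, (∀ p ∈ P, 0 ≤ L p) ∧ (∀ i, 0 ≤ L (f i)) ∧ ∀ j, 0 < L (g j) := by
  classical
  set Cn : Set V := {v | ∃ (δ : ι → ℝ) (p : V), (∀ i, 0 ≤ δ i) ∧ p ∈ P ∧
    v = ∑ i, δ i • f i + p} with hCn
  have hclosed : IsClosed Cn := isClosed_finite_cone_add f hP hsmul hf
  have hCsmul : ∀ c : ℝ, 0 ≤ c → ∀ x ∈ Cn, c • x ∈ Cn := by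
    rintro c hc _ ⟨δ, p, h1, h2, rfl⟩
    refine ⟨fun i => c * δ i, c • p, fun i => mul_nonneg hc (h1 i), hsmul c hc p h2, ?_⟩
    simp [mul_smul, Finset.smul_sum]
  have hCadd : ∀ x ∈ Cn, ∀ y ∈ Cn, x + y ∈ Cn := by
    rintro _ ⟨δ, p, h1, h2, rfl⟩ _ ⟨δ', p', h1', h2', rfl⟩
    refine ⟨fun i => δ i + δ' i, p + p', fun i => add_nonneg (h1 i) (h1' i),
      hadd _ h2 _ h2', ?_⟩
    simp only [add_smul, Finset.sum_add_distrib]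
    abel
  have hconv : Convex ℝ Cn := fun x hx y hy a b ha hb _ =>
    hCadd _ (hCsmul a ha x hx) _ (hCsmul b hb y hy)
  -- The sign is chosen so that a common point of the hull of the -g_j and the cone is exactly the
  -- first alternative.
  let G : (κ → ℝ) →L[ℝ] V := LinearMap.toContinuousLinearMap (-Fintype.linearCombination ℝ g)
  have hG : ∀ η, G η = -∑ j, η j • g j := fun η => by
    simp [G, Fintype.linearCombination_apply]
  have hQc : IsCompact (G '' stdSimplex ℝ κ) := (isCompact_stdSimplex ℝ κ).image G.continuous
  have hQv : Convex ℝ (G '' stdSimplex ℝ κ) :=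
    (convex_stdSimplex ℝ κ).linear_image G.toLinearMap
  by_cases hd : Disjoint (G '' stdSimplex ℝ κ) Cn
  · right
    obtain ⟨L, u, v, h1, huv, h2⟩ :=
      geometric_hahn_banach_compact_closed hQv hQc hconv hclosed hd
    have hPC : ∀ p ∈ P, p ∈ Cn := fun p hp => ⟨0, p, by simp, hp, by simp⟩
    have hfC : ∀ i, f i ∈ Cn := fun i =>
      ⟨Pi.single i 1, 0, fun j => by by_cases h : j = i <;> simp [h], h0, by
        simp [Pi.single_apply]⟩
    have hv : v < 0 := by simpa using h2 0 (hPC 0 h0)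
    have hL : ∀ x ∈ Cn, 0 ≤ L x := by
      intro x hx
      by_contra hneg
      push Not at hneg
      -- The rescaled point lies in the cone and has value exactly `v`, against the strict bound.
      have := h2 _ (hCsmul (v / L x) (div_nonneg_of_nonpos hv.le hneg.le) x hx)
      rw [map_smul, smul_eq_mul, div_mul_cancel₀ _ hneg.ne] at this
      exact lt_irrefl _ this
    refine ⟨L, fun p hp => hL p (hPC p hp), fun i => hL _ (hfC i), fun j => ?_⟩
    have := h1 (G (Pi.single j 1)) ⟨_, single_mem_stdSimplex ℝ j, rfl⟩
    rw [hG] at this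
    simp [Pi.single_apply] at this
    linarith
  · left
    rw [Set.not_disjoint_iff] at hd
    obtain ⟨_, ⟨η, hη, rfl⟩, δ, p, h1, h2, h3⟩ := hd
    refine ⟨δ, η, h1, hη.1, hη.2, ?_⟩
    rw [hG] at h3
    have : -(∑ i, δ i • f i + ∑ j, η j • g j) = p := by
      rw [neg_add, h3]; abel
    rwa [this]

end Cones

/-! ### Quadratic polynomials as symmetric matrices -/

section QuadraticForms

variable {ι : Type*} [Fintype ι]

/-- The value at `u` of the quadratic form with matrix `M`. -/
def quadValue (M : ι → ι → ℝ) (u : ι → ℝ) : ℝ := ∑ i, ∑ j, M i j * u i * u j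

/-- Symmetric positive semidefinite matrices. -/
def IsPSDForm (M : ι → ι → ℝ) : Prop := (∀ i j, M i j = M j i) ∧ ∀ u, 0 ≤ quadValue M u

theorem quadValue_add (M N : ι → ι → ℝ) (u : ι → ℝ) :
    quadValue (M + N) u = quadValue M u + quadValue N u := by
  simp [quadValue, add_mul, Finset.sum_add_distrib]

theorem quadValue_smul (c : ℝ) (M : ι → ι → ℝ) (u : ι → ℝ) :
    quadValue (c • M) u = c * quadValue M u := by
  simp [quadValue, Finset.mul_sum, mul_assoc]

theorem quadValue_zero (u : ι → ℝ) : quadValue (0 : ι → ι → ℝ) u = 0 := by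
  simp [quadValue]

theorem quadValue_neg (M : ι → ι → ℝ) (u : ι → ℝ) : quadValue (-M) u = -quadValue M u := by
  simp [quadValue]

theorem quadValue_sum {κ : Type*} (s : Finset κ) (M : κ → ι → ι → ℝ) (u : ι → ℝ) :
    quadValue (∑ k ∈ s, M k) u = ∑ k ∈ s, quadValue (M k) u := by
  classical
  induction s using Finset.induction_on with
  | empty => simp [quadValue_zero]
  | insert a s ha ih => rw [Finset.sum_insert ha, Finset.sum_insert ha, quadValue_add, ih]

theorem quadValue_smul_vec (M : ι → ι → ℝ) (c : ℝ) (u : ι → ℝ) :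
    quadValue M (c • u) = c ^ 2 * quadValue M u := by
  simp only [quadValue, Finset.mul_sum, Pi.smul_apply, smul_eq_mul]
  refine Finset.sum_congr rfl fun i _ => Finset.sum_congr rfl fun j _ => ?_
  ring

/-- The matrix of the form `u ↦ quadValue M (D u)`. -/
def congruentForm {κ : Type*} (D : ι → κ → ℝ) (M : ι → ι → ℝ) (k l : κ) : ℝ :=
  ∑ i, ∑ j, D i k * M i j * D j l

theorem congruentForm_symm {κ : Type*} (D : ι → κ → ℝ) {M : ι → ι → ℝ}
    (hM : ∀ i j, M i j = M j i) (k l : κ) : congruentForm D M k l = congruentForm D M l k := by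
  unfold congruentForm
  rw [Finset.sum_comm]
  refine Finset.sum_congr rfl fun i _ => Finset.sum_congr rfl fun j _ => ?_
  rw [hM j i]; ring

theorem quadValue_congruentForm {κ : Type*} [Fintype κ] (D : ι → κ → ℝ) (M : ι → ι → ℝ)
    (u : κ → ℝ) :
    quadValue (congruentForm D M) u = quadValue M (fun i => ∑ k, D i k * u k) := by
  have h : ∀ i j, M i j * (∑ k, D i k * u k) * (∑ l, D j l * u l) =
      ∑ k, ∑ l, D i k * M i j * D j l * u k * u l := fun i j => by
    rw [mul_assoc, Finset.sum_mul_sum, Finset.mul_sum]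
    refine Finset.sum_congr rfl fun k _ => ?_
    rw [Finset.mul_sum]
    exact Finset.sum_congr rfl fun l _ => by ring
  simp only [quadValue, congruentForm, h, Finset.sum_mul]
  calc ∑ k, ∑ l, ∑ i, ∑ j, D i k * M i j * D j l * u k * u l
      = ∑ k, ∑ i, ∑ l, ∑ j, D i k * M i j * D j l * u k * u l :=
        Finset.sum_congr rfl fun k _ => Finset.sum_comm
    _ = ∑ i, ∑ k, ∑ j, ∑ l, D i k * M i j * D j l * u k * u l := by
        rw [Finset.sum_comm]
        exact Finset.sum_congr rfl fun i _ => Finset.sum_congr rfl fun k _ => Finset.sum_comm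
    _ = _ := Finset.sum_congr rfl fun i _ => Finset.sum_comm

theorem quadValue_single_add [DecidableEq ι] {M : ι → ι → ℝ} (hM : ∀ i j, M i j = M j i)
    (i j : ι) (s t : ℝ) :
    quadValue M (Pi.single i s + Pi.single j t) =
      M i i * s ^ 2 + 2 * M i j * s * t + M j j * t ^ 2 := by
  simp only [quadValue, Pi.add_apply, mul_add, add_mul, Finset.sum_add_distrib, Pi.single_apply,
    mul_ite, ite_mul, mul_zero, zero_mul, Finset.sum_ite_eq', Finset.mem_univ, if_true]
  rw [hM j i]
  ring

theorem IsPSDForm.diag_nonneg {M : ι → ι → ℝ} (hM : IsPSDForm M) (i : ι) : 0 ≤ M i i := by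
  classical
  have := hM.2 (Pi.single i 1 + Pi.single i 0)
  rw [quadValue_single_add hM.1] at this
  simpa using this

/-- With a zero diagonal entry the form is affine along that coordinate direction. A nonzero slope
`2 * M i j` would make it unbounded below; the chosen point gives the value -1. -/
theorem IsPSDForm.row_eq_zero {M : ι → ι → ℝ} (hM : IsPSDForm M) {i : ι} (hi : M i i = 0)
    (j : ι) : M i j = 0 := by
  classical
  by_contra hne
  have := hM.2 (Pi.single i (-(M j j + 1) / (2 * M i j)) + Pi.single j 1)
  rw [quadValue_single_add hM.1, hi] at this
  have h2 : 2 * M i j * (-(M j j + 1) / (2 * M i j)) = -(M j j + 1) := by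
    field_simp
  rw [h2] at this
  linarith

theorem IsPSDForm.zero : IsPSDForm (0 : ι → ι → ℝ) :=
  ⟨fun _ _ => rfl, fun u => (quadValue_zero u).ge⟩

theorem IsPSDForm.add {M N : ι → ι → ℝ} (hM : IsPSDForm M) (hN : IsPSDForm N) :
    IsPSDForm (M + N) :=
  ⟨fun i j => by simp only [Pi.add_apply, hM.1 i j, hN.1 i j], fun u => by
    rw [quadValue_add]; exact add_nonneg (hM.2 u) (hN.2 u)⟩

theorem IsPSDForm.smul {M : ι → ι → ℝ} (hM : IsPSDForm M) {c : ℝ} (hc : 0 ≤ c) :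
    IsPSDForm (c • M) :=
  ⟨fun i j => by simp only [Pi.smul_apply, hM.1 i j], fun u => by
    rw [quadValue_smul]; exact mul_nonneg hc (hM.2 u)⟩

theorem isClosed_isPSDForm : IsClosed {M : ι → ι → ℝ | IsPSDForm M} := by
  have h1 : IsClosed {M : ι → ι → ℝ | ∀ i j, M i j = M j i} := by
    simp only [Set.ofPred_forall]
    exact isClosed_iInter fun i => isClosed_iInter fun j => isClosed_eq (by fun_prop) (by fun_prop)
  have h2 : IsClosed {M : ι → ι → ℝ | ∀ u, 0 ≤ quadValue M u} := by
    simp only [Set.ofPred_forall, quadValue]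
    exact isClosed_iInter fun u => isClosed_le continuous_const (by fun_prop)
  exact h1.inter h2

/-- One step of the completion of squares: the Schur complement of a pivot. -/
noncomputable def schurForm {κ : Type*} (M : κ → κ → ℝ) (p i j : κ) : ℝ := M i j - M i p * M p j / M p p

theorem quadValue_eq_schurForm {M : ι → ι → ℝ} (hM : ∀ i j, M i j = M j i) {p : ι}
    (u : ι → ℝ) :
    quadValue M u = (∑ j, M p j * u j) ^ 2 / M p p + quadValue (schurForm M p) u := by
  have h : (∑ j, M p j * u j) ^ 2 / M p p = ∑ i, ∑ j, M i p * M p j / M p p * u i * u j := by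
    rw [sq, Finset.sum_mul_sum, Finset.sum_div]
    refine Finset.sum_congr rfl fun i _ => ?_
    rw [Finset.sum_div]
    refine Finset.sum_congr rfl fun j _ => ?_
    rw [hM i p]; ring
  rw [h]
  simp only [quadValue, schurForm, sub_mul, Finset.sum_sub_distrib]
  ring

theorem schurForm_pivot_left {κ : Type*} {M : κ → κ → ℝ} {p : κ} (hp : M p p ≠ 0) (j : κ) :
    schurForm M p p j = 0 := by
  simp [schurForm, hp]

theorem schurForm_pivot_right {κ : Type*} {M : κ → κ → ℝ} {p : κ} (hp : M p p ≠ 0) (i : κ) :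
    schurForm M p i p = 0 := by
  simp [schurForm, hp]

/-- The Schur form does not depend on the pivot coordinate. That coordinate can therefore be moved
to the point where the split-off square vanishes, and there the Schur form agrees with the original
one. -/
theorem IsPSDForm.schur {M : ι → ι → ℝ} (hM : IsPSDForm M) {p : ι} (hp : M p p ≠ 0) :
    IsPSDForm (schurForm M p) := by
  classical
  refine ⟨fun i j => ?_, fun u => ?_⟩
  · simp only [schurForm]
    rw [hM.1 i j, hM.1 i p, hM.1 p j]; ring
  · set t := (∑ j, M p j * u j) / M p p with ht
    set w := Function.update u p (u p - t) with hw
    have h1 : ∑ j, M p j * w j = 0 := by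
      have : ∀ j, M p j * w j = M p j * u j - if j = p then M p p * t else 0 := fun j => by
        by_cases h : j = p
        · subst h; simp [hw]; ring
        · simp [hw, h]
      simp only [this, Finset.sum_sub_distrib, Finset.sum_ite_eq', Finset.mem_univ, if_true]
      rw [ht, mul_div_cancel₀ _ hp, sub_self]
    have h2 : quadValue (schurForm M p) w = quadValue (schurForm M p) u := by
      refine Finset.sum_congr rfl fun i _ => Finset.sum_congr rfl fun j _ => ?_
      by_cases hi : i = p
      · subst hi; simp [schurForm_pivot_left hp]
      · by_cases hj : j = p
        · subst hj; simp [schurForm_pivot_right hp]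
        · simp [hw, hi, hj]
    have h3 := hM.2 w
    rw [quadValue_eq_schurForm hM.1 (p := p), h1, h2] at h3
    simpa using h3

end QuadraticForms

/-! ### Completion of squares along an elimination order -/

section SquareCompletion

variable {n : ℕ}

/-- Completion of squares in the order given by `key`. If the coupling relation `R` of `M` is
preserved by eliminating a variable of smaller key, then the affine forms whose squares appear
involve only variables of larger key related to the eliminated one. -/
theorem IsPSDForm.exists_squares (key : Fin n → ℕ) (hkey : Function.Injective key)
    (R : Fin n → Fin n → Prop)
    (hR : ∀ p v w, key p < key v → key p < key w → R v p → R p w → R v w)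
    (M : Option (Fin n) → Option (Fin n) → ℝ) (hM : IsPSDForm M)
    (hMR : ∀ v w, M (some v) (some w) ≠ 0 → R v w) :
    ∃ (a : Fin n → ℝ) (a₀ : ℝ) (c : Fin n → Option (Fin n) → ℝ),
      (∀ v, 0 ≤ a v) ∧ 0 ≤ a₀ ∧ (∀ v, M (some v) (some v) = 0 → a v = 0) ∧
      (∀ v w, c v (some w) ≠ 0 → key v < key w ∧ R v w) ∧
      ∀ u, quadValue M u =
        ∑ v, a v * (u (some v) - ∑ k, c v k * u k) ^ 2 + a₀ * u none ^ 2 := by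
  classical
  -- Pivoting on the nonzero diagonal entry of least key removes at least one such entry and creates
  -- none. The constant coordinate `none` is never a pivot; what is left at it becomes `a₀`.
  induction hN : (Finset.univ.filter fun v => M (some v) (some v) ≠ 0).card
    using Nat.strong_induction_on generalizing M with
  | _ N ih =>
  rcases (Finset.univ.filter fun v => M (some v) (some v) ≠ 0).eq_empty_or_nonempty with he | hne
  · have hz : ∀ v, M (some v) (some v) = 0 := fun v => by
      by_contra h
      have : v ∈ (Finset.univ.filter fun v => M (some v) (some v) ≠ 0) := by simp [h]
      simp [he] at this
    refine ⟨0, M none none, 0, by simp, hM.diag_nonneg none, by simp, by simp, fun u => ?_⟩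
    have h1 : ∀ v j, M (some v) j = 0 := fun v j => hM.row_eq_zero (hz v) j
    have h2 : ∀ v, M none (some v) = 0 := fun v => by rw [hM.1, h1]
    simp [quadValue, Fintype.sum_option, h1, h2]
    ring
  · obtain ⟨p, hp, hmin⟩ := Finset.exists_min_image _ key hne
    replace hp : M (some p) (some p) ≠ 0 := by simpa using hp
    replace hmin : ∀ w, M (some w) (some w) ≠ 0 → w ≠ p → key p < key w := fun w hw hwp =>
      lt_of_le_of_ne (hmin w (by simpa using hw)) fun h => hwp (hkey h.symm)
    have hS := hM.schur hp
    have hdiag : ∀ v j, M (some v) j ≠ 0 → M (some v) (some v) ≠ 0 := fun v j h h' =>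
      h (hM.row_eq_zero h' j)
    have hSdiag : ∀ v, M (some v) (some v) = 0 →
        schurForm M (some p) (some v) (some v) = 0 := fun v hv => by
      simp [schurForm, hv, hM.row_eq_zero hv]
    have hlt : (Finset.univ.filter fun v =>
        schurForm M (some p) (some v) (some v) ≠ 0).card < N := by
      rw [← hN]
      apply Finset.card_lt_card
      rw [Finset.ssubset_iff_of_subset]
      · exact ⟨p, by simpa using hp, by simp [schurForm_pivot_left hp]⟩
      · intro v
        simp only [Finset.mem_filter, Finset.mem_univ, true_and]
        exact fun h h' => h (hSdiag v h')
    -- Fill-in: an entry that was zero becomes nonzero only if both indices are coupled with the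
    -- pivot, and both have larger key by minimality. This is the situation covered by `hR`.
    have hSR : ∀ v w, schurForm M (some p) (some v) (some w) ≠ 0 → R v w := by
      intro v w h
      have hv : v ≠ p := by rintro rfl; exact h (schurForm_pivot_left hp _)
      have hw : w ≠ p := by rintro rfl; exact h (schurForm_pivot_right hp _)
      by_cases hvw : M (some v) (some w) = 0
      · have h1 : M (some v) (some p) ≠ 0 := fun h0 => h (by simp [schurForm, hvw, h0])
        have h2 : M (some p) (some w) ≠ 0 := fun h0 => h (by simp [schurForm, hvw, h0])
        refine hR p v w (hmin v (hdiag _ _ h1) hv) (hmin w ?_ hw) (hMR _ _ h1) (hMR _ _ h2)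
        exact hdiag w (some p) (by rwa [hM.1])
      · exact hMR v w hvw
    obtain ⟨a, a₀, c, ha, ha₀, haz, hc, hq⟩ := ih _ hlt _ hS hSR rfl
    -- The slot of `p` is unused by the remaining squares, hence free for the square just split off.
    have hap : a p = 0 := haz p (schurForm_pivot_left hp _)
    refine ⟨fun v => if v = p then M (some p) (some p) else a v, a₀,
      fun v k => if v = p then (if k = some p then 0 else -(M (some p) k / M (some p) (some p)))
        else c v k, ?_, ha₀, ?_, ?_, ?_⟩
    · intro v
      dsimp only
      split_ifs
      · exact hM.diag_nonneg _
      · exact ha v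
    · intro v hv
      dsimp only
      split_ifs with h
      · subst h; exact hv
      · exact haz v (hSdiag v hv)
    · intro v w h
      dsimp only at h
      split_ifs at h with h1 h2
      · exact absurd rfl h
      · subst h1
        have h3 : M (some v) (some w) ≠ 0 := fun h0 => h (by simp [h0])
        refine ⟨hmin w (hdiag w (some v) (by rwa [hM.1])) fun h4 => h2 (by rw [h4]), hMR _ _ h3⟩
      · exact hc v w h
    · intro u
      rw [quadValue_eq_schurForm hM.1 (p := some p), hq u, ← add_assoc]
      congr 1
      rw [← Finset.add_sum_erase _ _ (Finset.mem_univ p),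
        ← Finset.add_sum_erase _ _ (Finset.mem_univ p), hap, zero_mul, zero_add]
      congr 1
      · simp only [if_true]
        have h1 : u (some p) - ∑ k, (if k = some p then 0
            else -(M (some p) k / M (some p) (some p))) * u k =
            (∑ j, M (some p) j * u j) / M (some p) (some p) := by
          rw [← Finset.add_sum_erase _ _ (Finset.mem_univ (some p)),
            ← Finset.add_sum_erase _ _ (Finset.mem_univ (some p)), if_pos rfl, zero_mul, zero_add,
            add_div, mul_div_cancel_left₀ _ hp, sub_eq_add_neg, Finset.sum_div,
            ← Finset.sum_neg_distrib]
          congr 1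
          refine Finset.sum_congr rfl fun k hk => ?_
          rw [if_neg (Finset.ne_of_mem_erase hk)]
          ring
        rw [h1]
        field_simp
      · refine Finset.sum_congr rfl fun v hv => ?_
        have := Finset.ne_of_mem_erase hv
        simp only [this, if_false]

end SquareCompletion

/-! ### Affine and quadratic polynomials in homogeneous coordinates -/

section Polynomials

variable {n : ℕ}

/-- The homogeneous coordinates `(1, x)` of a point. -/
def homog {R : Type*} [One R] (x : Fin n → R) (k : Option (Fin n)) : R := k.elim 1 x

@[simp] theorem homog_none {R : Type*} [One R] (x : Fin n → R) : homog x none = 1 := rfl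

@[simp] theorem homog_some {R : Type*} [One R] (x : Fin n → R) (v : Fin n) :
    homog x (some v) = x v := rfl

/-- The affine polynomial with the given homogeneous coefficients. -/
noncomputable def affinePoly (c : Option (Fin n) → ℝ) : MvPolynomial (Fin n) ℝ :=
  ∑ k, C (c k) * homog X k

/-- The quadratic polynomial with the given homogeneous matrix. -/
noncomputable def quadPoly (M : Option (Fin n) → Option (Fin n) → ℝ) : MvPolynomial (Fin n) ℝ :=
  ∑ i, ∑ j, C (M i j) * homog X i * homog X j

theorem eval_affinePoly (c : Option (Fin n) → ℝ) (x : Fin n → ℝ) :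
    eval x (affinePoly c) = ∑ k, c k * homog x k := by
  simp [affinePoly]

theorem eval_quadPoly (M : Option (Fin n) → Option (Fin n) → ℝ) (x : Fin n → ℝ) :
    eval x (quadPoly M) = quadValue M (homog x) := by
  simp [quadPoly, quadValue]

theorem totalDegree_affinePoly_le (c : Option (Fin n) → ℝ) :
    (affinePoly c).totalDegree ≤ 1 := by
  refine totalDegree_finsetSum_le fun k _ => (totalDegree_mul _ _).trans ?_
  rw [totalDegree_C, zero_add]
  cases k <;> simp

theorem vars_affinePoly_subset (c : Option (Fin n) → ℝ) {S : Finset (Fin n)}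
    (h : ∀ w, c (some w) ≠ 0 → w ∈ S) : (affinePoly c).vars ⊆ S := by
  intro w hw
  obtain ⟨k, -, hk⟩ := Finset.mem_biUnion.1 (vars_sum_subset _ _ hw)
  rcases k with _ | v
  · simp at hk
  · by_cases hv : c (some v) = 0
    · simp [hv] at hk
    · have := vars_mul _ _ hk
      simp only [vars_C, Finset.empty_union, homog_some, vars_X, Finset.mem_singleton] at this
      exact this ▸ h v hv

theorem exists_eq_affinePoly {p : MvPolynomial (Fin n) ℝ} (hp : p.totalDegree ≤ 1) :
    ∃ c, p = affinePoly c := by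
  refine ⟨fun k => k.elim (coeff 0 p) fun v => coeff (Finsupp.single v 1) p, ?_⟩
  ext m
  simp only [affinePoly, Fintype.sum_option, coeff_add, coeff_sum, coeff_C_mul, Option.elim,
    homog_none, homog_some, mul_one, coeff_C, coeff_X]
  by_cases h0 : m = 0
  · subst h0
    simp
  rw [if_neg (Ne.symm h0), zero_add]
  by_cases h1 : ∃ v, m = Finsupp.single v 1
  · obtain ⟨v, rfl⟩ := h1
    simp [Finsupp.single_left_inj]
  · push Not at h1
    rw [Finset.sum_eq_zero fun v _ => by rw [if_neg (Ne.symm (h1 v)), mul_zero]]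
    by_contra hm
    have h2 := (le_totalDegree (mem_support_iff.2 hm)).trans hp
    obtain ⟨v, hv⟩ : ∃ v, m v ≠ 0 := by
      by_contra! h
      exact h0 (Finsupp.ext h)
    apply h1 v
    have h3 : m.sum (fun _ e => e) = ∑ w, m w := Finsupp.sum_fintype _ _ (by simp)
    rw [h3] at h2
    ext w
    by_cases hw : w = v
    · subst hw
      have := Finset.single_le_sum (f := m) (fun i _ => Nat.zero_le _) (Finset.mem_univ w)
      simp
      omega
    · have h4 : m v + m w ≤ ∑ w, m w := by
        rw [← Finset.add_sum_erase _ _ (Finset.mem_univ v)]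
        exact Nat.add_le_add_left (Finset.single_le_sum (f := m) (fun i _ => Nat.zero_le _)
          (Finset.mem_erase.2 ⟨hw, Finset.mem_univ w⟩)) _
      simp [Ne.symm hw]
      omega

theorem eval_congr_vars {p : MvPolynomial (Fin n) ℝ} {x y : Fin n → ℝ}
    (h : ∀ v ∈ p.vars, x v = y v) : eval x p = eval y p :=
  eval₂Hom_congr' rfl (fun v hv _ => h v hv) rfl

theorem eval_bind₁_apply (σ : Fin n → MvPolynomial (Fin n) ℝ) (p : MvPolynomial (Fin n) ℝ)
    (x : Fin n → ℝ) : eval x (bind₁ σ p) = eval (fun v => eval x (σ v)) p := by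
  simp only [eval, eval₂Hom_bind₁]

theorem IsConcaveQuadratic.exists_form {p : MvPolynomial (Fin n) ℝ} (hp : IsConcaveQuadratic p) :
    ∃ M : Option (Fin n) → Option (Fin n) → ℝ, (∀ i j, M i j = M j i) ∧
      (∀ u, u none = 0 → quadValue M u ≤ 0) ∧
      (∀ v ∉ p.vars, ∀ j, M (some v) j = 0) ∧ p = quadPoly M := by
  classical
  obtain ⟨A, α, a, hs, hA, h⟩ := hp
  let M₀ : Option (Fin n) → Option (Fin n) → ℝ := fun i j =>
    i.elim (j.elim a α) fun v => j.elim (α v) fun w => A v w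
  have hsymm : ∀ i j, M₀ i j = M₀ j i := by
    rintro (_ | v) (_ | w) <;> simp [M₀]
    exact (hs.apply w v)
  have hneg : ∀ u : Option (Fin n) → ℝ, u none = 0 → quadValue M₀ u ≤ 0 := fun u hu => by
    have := hA.dotProduct_mulVec_nonneg fun v => u (some v)
    simp only [dotProduct, Matrix.mulVec, Matrix.neg_apply, Pi.star_apply, star_trivial,
      Finset.mul_sum] at this
    rw [← neg_nonneg]
    refine this.trans_eq ?_
    simp only [quadValue, Fintype.sum_option, hu, M₀, Option.elim, mul_zero, zero_mul,
      Finset.sum_const_zero, zero_add, ← Finset.sum_neg_distrib]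
    exact Finset.sum_congr rfl fun i _ => Finset.sum_congr rfl fun j _ => by ring
  have hval : ∀ x, eval x p = quadValue M₀ (homog x) := fun x => by
    rw [h]
    simp only [map_add, map_sum, map_mul, eval_C, eval_X, map_ofNat, quadValue,
      Fintype.sum_option, M₀, Option.elim, homog_none, homog_some, mul_one,
      Finset.sum_add_distrib]
    ring
  -- Masking sets the variables outside `p.vars` to zero. This does not change `p`, and it clears
  -- their rows without comparing coefficients.
  let s : Option (Fin n) → ℝ := fun k => k.elim 1 fun v => if v ∈ p.vars then 1 else 0
  have hq : ∀ u, quadValue (fun i j => s i * M₀ i j * s j) u =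
      quadValue M₀ (fun k => s k * u k) := fun u =>
    Finset.sum_congr rfl fun i _ => Finset.sum_congr rfl fun j _ => by ring
  refine ⟨fun i j => s i * M₀ i j * s j, fun i j => ?_, fun u hu => ?_, fun v hv j => ?_, ?_⟩
  · dsimp only
    rw [hsymm i j]; ring
  · rw [hq]
    exact hneg _ (by simp [hu])
  · simp [s, hv]
  · refine MvPolynomial.funext fun x => ?_
    rw [eval_quadPoly, hq]
    have : (fun k => s k * homog x k) = homog fun v => s (some v) * x v := by
      funext k; cases k <;> simp [s]
    rw [this, ← hval]
    refine eval_congr_vars fun v hv => ?_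
    simp [s, hv]

theorem isConcaveQuadratic_quadPoly {M : Option (Fin n) → Option (Fin n) → ℝ}
    (hM : ∀ i j, M i j = M j i) (hneg : ∀ u, u none = 0 → quadValue M u ≤ 0) :
    IsConcaveQuadratic (quadPoly M) := by
  refine ⟨Matrix.of fun v w => M (some v) (some w), fun v => M none (some v), M none none,
    Matrix.IsSymm.ext fun v w => hM _ _, ?_, ?_⟩
  · refine Matrix.PosSemidef.of_dotProduct_mulVec_nonneg ?_ fun x => ?_
    · ext v w
      simp [hM (some v) (some w)]
    · have := hneg (fun k => k.elim 0 x) rfl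
      rw [← neg_nonneg] at this
      refine this.trans_eq ?_
      simp only [dotProduct, Matrix.mulVec, Matrix.neg_apply, Pi.star_apply, star_trivial,
        Finset.mul_sum, quadValue, Fintype.sum_option, Option.elim, mul_zero, zero_mul,
        Finset.sum_const_zero, zero_add, ← Finset.sum_neg_distrib, Matrix.of_apply]
      exact Finset.sum_congr rfl fun i _ => Finset.sum_congr rfl fun j _ => by ring
  · refine MvPolynomial.funext fun x => ?_
    rw [eval_quadPoly]
    simp only [map_add, map_sum, map_mul, eval_C, eval_X, map_ofNat, quadValue,
      Fintype.sum_option, homog_none, homog_some, mul_one, hM (some _) none,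
      Finset.sum_add_distrib, Matrix.of_apply]
    ring

theorem isConcaveQuadratic_zero : IsConcaveQuadratic (0 : MvPolynomial (Fin n) ℝ) := by
  have := isConcaveQuadratic_quadPoly (M := (0 : Option (Fin n) → Option (Fin n) → ℝ))
    (fun _ _ => rfl) fun u _ => (quadValue_zero u).le
  rwa [show quadPoly (0 : Option (Fin n) → Option (Fin n) → ℝ) = 0 by simp [quadPoly]] at this

/-- An affine substitution is a linear map of homogeneous coordinates fixing the constant one. It
preserves the hyperplane `u none = 0`, on which concavity is a sign condition. -/
theorem IsConcaveQuadratic.bind₁ {p : MvPolynomial (Fin n) ℝ} (hp : IsConcaveQuadratic p)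
    {σ : Fin n → MvPolynomial (Fin n) ℝ} (hσ : ∀ v, (σ v).totalDegree ≤ 1) :
    IsConcaveQuadratic (MvPolynomial.bind₁ σ p) := by
  classical
  obtain ⟨M, hM, hneg, -, rfl⟩ := hp.exists_form
  choose c hc using fun v => exists_eq_affinePoly (hσ v)
  let D : Option (Fin n) → Option (Fin n) → ℝ := fun i => i.elim (Pi.single none 1) c
  have : MvPolynomial.bind₁ σ (quadPoly M) = quadPoly (congruentForm D M) := by
    refine MvPolynomial.funext fun x => ?_
    rw [eval_bind₁_apply, eval_quadPoly, eval_quadPoly, quadValue_congruentForm]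
    congr 1
    funext k
    cases k with
    | none => simp [D, Pi.single_apply]
    | some v => simp [D, hc v, eval_affinePoly]
  rw [this]
  refine isConcaveQuadratic_quadPoly (congruentForm_symm D hM) fun u hu => ?_
  rw [quadValue_congruentForm]
  exact hneg _ (by simp [D, Pi.single_apply, hu])

/-- A vector with nonzero constant coordinate is a multiple of some (1, x), where the polynomial
gives the sign. The vectors at infinity are left to `h0`, which concavity supplies in the
application. -/
theorem isPSDForm_of_eval_nonneg {M : Option (Fin n) → Option (Fin n) → ℝ}
    (hM : ∀ i j, M i j = M j i) (h0 : ∀ u, u none = 0 → 0 ≤ quadValue M u)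
    (h : ∀ x, 0 ≤ eval x (quadPoly M)) : IsPSDForm M := by
  refine ⟨hM, fun u => ?_⟩
  by_cases hu : u none = 0
  · exact h0 u hu
  · have : u = u none • homog fun v => u (some v) / u none := by
      funext k
      cases k with
      | none => simp
      | some v => simp [mul_div_cancel₀ _ hu]
    rw [this, quadValue_smul_vec, ← eval_quadPoly]
    exact mul_nonneg (sq_nonneg _) (h _)

/-- Only the diagonal needs to be recovered, since a semidefinite matrix with zero diagonal
vanishes. The values at the origin and at the coordinate vectors suffice. -/
theorem IsPSDForm.eq_zero_of_quadPoly {M : Option (Fin n) → Option (Fin n) → ℝ}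
    (hM : IsPSDForm M) (h : quadPoly M = 0) : M = 0 := by
  classical
  have hv : ∀ x, quadValue M (homog x) = 0 := fun x => by rw [← eval_quadPoly, h, map_zero]
  have h0 : M none none = 0 := by
    have := hv 0
    simpa [quadValue, Fintype.sum_option] using this
  have hd : ∀ i, M i i = 0 := by
    rintro (_ | v)
    · exact h0
    · have h1 := hv (Pi.single v 1)
      have h2 : homog (Pi.single v (1 : ℝ)) = Pi.single none 1 + Pi.single (some v) 1 := by
        funext k
        cases k with
        | none => simp
        | some w => simp [Pi.single_apply]
      rw [h2, quadValue_single_add hM.1, h0, hM.row_eq_zero h0] at h1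
      simpa using h1
  funext i j
  exact hM.row_eq_zero (hd i) j

theorem quadPoly_add (M N : Option (Fin n) → Option (Fin n) → ℝ) :
    quadPoly (M + N) = quadPoly M + quadPoly N :=
  MvPolynomial.funext fun x => by simp only [map_add, eval_quadPoly, quadValue_add]

theorem quadPoly_neg (M : Option (Fin n) → Option (Fin n) → ℝ) :
    quadPoly (-M) = -quadPoly M :=
  MvPolynomial.funext fun x => by simp only [map_neg, eval_quadPoly, quadValue_neg]

theorem quadPoly_sum_smul {κ : Type*} [Fintype κ] (δ : κ → ℝ)
    (M : κ → Option (Fin n) → Option (Fin n) → ℝ) :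
    quadPoly (∑ k, δ k • M k) = ∑ k, C (δ k) * quadPoly (M k) :=
  MvPolynomial.funext fun x => by
    simp only [map_sum, map_mul, eval_C, eval_quadPoly, quadValue_sum, quadValue_smul]

/-- The matrix units. -/
def unitForm (a b i j : Option (Fin n)) : ℝ := if i = a ∧ j = b then 1 else 0

/-- Jensen's inequality for concave quadratic polynomials and a positive functional, evaluated at
the barycentre of the functional. -/
theorem exists_barycentre (L : (Option (Fin n) → Option (Fin n) → ℝ) →ₗ[ℝ] ℝ)
    (hL : ∀ N, IsPSDForm N → 0 ≤ L N) (h1 : 0 < L (unitForm none none)) :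
    ∃ x : Fin n → ℝ, ∀ M, (∀ i j, M i j = M j i) → (∀ u, u none = 0 → quadValue M u ≤ 0) →
      L M ≤ L (unitForm none none) * eval x (quadPoly M) := by
  classical
  set ℓ := L (unitForm none none) with hℓ
  let E : Fin n → Option (Fin n) → Option (Fin n) → ℝ := fun v =>
    unitForm none (some v) + unitForm (some v) none
  -- `E v` is the symmetric matrix of the polynomial 2 v, hence the factor 2 in the denominator.
  let x : Fin n → ℝ := fun v => L (E v) / (2 * ℓ)
  refine ⟨x, fun M hM hneg => ?_⟩
  -- `D` is the centering map (t, u) ↦ (0, u - t x). Its image lies at infinity, where `M` is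
  -- nonpositive, so `N` is semidefinite.
  let D : Option (Fin n) → Option (Fin n) → ℝ := fun i =>
    i.elim 0 fun v k => k.elim (-x v) fun w => if v = w then 1 else 0
  set N := -congruentForm D M with hN
  have hNpsd : IsPSDForm N := by
    refine ⟨fun i j => ?_, fun u => ?_⟩
    · simp only [hN, Pi.neg_apply, congruentForm_symm D hM i j]
    · rw [hN, quadValue_neg, quadValue_congruentForm, neg_nonneg]
      exact hneg _ (by simp [D])
  let β : Fin n → ℝ := fun v => M none (some v) + ∑ w, x w * M (some w) (some v)
  let c : ℝ := M none none - ∑ v, ∑ w, x v * M (some v) (some w) * x w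
  -- Adding `N` cancels the purely quadratic part of `M` and leaves its tangent at `x`; on an affine
  -- polynomial `L` acts as ℓ times evaluation at `x`.
  have hsum : M + N = c • (unitForm none none) + ∑ v, β v • E v := by
    funext i j
    simp only [hN, Pi.add_apply, Pi.neg_apply, congruentForm, Fintype.sum_option, D, Option.elim,
      Finset.sum_apply, Pi.smul_apply, smul_eq_mul, E, unitForm]
    rcases i with _ | v <;> rcases j with _ | w
    · simp [c]
      ring
    · simp [β]
    · simp [β, hM (some v) none]
      refine Finset.sum_congr rfl fun w _ => ?_
      rw [hM (some v), mul_comm]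
    · simp
  have hLsum : L M + L N = ℓ * eval x (quadPoly M) := by
    have h2 : ∀ v, L (E v) = 2 * ℓ * x v := fun v => by
      simp only [x]; field_simp
    rw [← map_add, hsum, map_add, map_smul, map_sum]
    simp only [map_smul, h2, smul_eq_mul, eval_quadPoly, quadValue, Fintype.sum_option,
      homog_none, homog_some, mul_one, c, β, Finset.sum_add_distrib, ← hℓ, add_mul,
      hM (some _) none]
    have h3 : ∑ v, (∑ w, x w * M (some w) (some v)) * (2 * ℓ * x v) =
        2 * ℓ * ∑ v, ∑ w, x v * M (some v) (some w) * x w := by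
      rw [Finset.sum_comm' (t' := Finset.univ) (s' := fun _ => Finset.univ) (by simp)]
      rw [Finset.mul_sum]
      refine Finset.sum_congr rfl fun v _ => ?_
      rw [Finset.sum_mul, Finset.mul_sum]
      exact Finset.sum_congr rfl fun w _ => by ring
    have h4 : ∑ v, M none (some v) * (2 * ℓ * x v) = 2 * ℓ * ∑ v, M none (some v) * x v := by
      rw [Finset.mul_sum]
      exact Finset.sum_congr rfl fun v _ => by ring
    have h5 : ∑ v, ∑ w, M (some v) (some w) * x v * x w =
        ∑ v, ∑ w, x v * M (some v) (some w) * x w :=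
      Finset.sum_congr rfl fun v _ => Finset.sum_congr rfl fun w _ => by ring
    rw [h3, h4, h5]
    ring
  have := hL N hNpsd
  linarith

end Polynomials

/-! ### Formulas and systems -/

theorem PolyFormula.holds_conj {n : ℕ} (L : List (PolyFormula n)) (x : Fin n → ℝ) :
    (PolyFormula.conj L).Holds x ↔ ∀ A ∈ L, A.Holds x := by
  induction L with
  | nil => simp [PolyFormula.conj, PolyFormula.Holds]
  | cons A L ih => simp [PolyFormula.conj, PolyFormula.Holds, ih]

theorem PolyFormula.mem_vars_conj {n : ℕ} (L : List (PolyFormula n)) (v : Fin n) :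
    v ∈ (PolyFormula.conj L).vars ↔ ∃ A ∈ L, v ∈ A.vars := by
  induction L with
  | nil => simp [PolyFormula.conj, PolyFormula.vars]
  | cons A L ih => simp [PolyFormula.conj, PolyFormula.vars, ih]

namespace IneqSystem

variable {n : ℕ}

theorem holds_iff (φ : IneqSystem n) (x : Fin n → ℝ) :
    φ.toFormula.Holds x ↔ (∀ i, 0 ≤ eval x (φ.f i)) ∧ ∀ j, 0 < eval x (φ.g j) := by
  simp [toFormula, PolyFormula.Holds, PolyFormula.holds_conj, List.mem_ofFn]

theorem mem_vars_iff (φ : IneqSystem n) (v : Fin n) :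
    v ∈ φ.vars ↔ (∃ i, v ∈ (φ.f i).vars) ∨ ∃ j, v ∈ (φ.g j).vars := by
  simp [vars, toFormula, PolyFormula.vars, PolyFormula.mem_vars_conj, List.mem_ofFn]

theorem vars_f_subset (φ : IneqSystem n) (i : Fin φ.r) : (φ.f i).vars ⊆ φ.vars := fun v hv =>
  (φ.mem_vars_iff v).2 (Or.inl ⟨i, hv⟩)

theorem vars_g_subset (φ : IneqSystem n) (j : Fin φ.s) : (φ.g j).vars ⊆ φ.vars := fun v hv =>
  (φ.mem_vars_iff v).2 (Or.inr ⟨j, hv⟩)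

theorem vars_sum_C_mul_subset {κ : Type*} [Fintype κ] (c : κ → ℝ)
    (p : κ → MvPolynomial (Fin n) ℝ) {S : Finset (Fin n)} (h : ∀ k, (p k).vars ⊆ S) :
    (∑ k, C (c k) * p k).vars ⊆ S := by
  intro v hv
  obtain ⟨k, -, hk⟩ := Finset.mem_biUnion.1 (vars_sum_subset _ _ hv)
  have := vars_mul _ _ hk
  rw [vars_C, Finset.empty_union] at this
  exact h k this

theorem vars_combF_subset (φ : IneqSystem n) (δ : Fin φ.r → ℝ) : (φ.combF δ).vars ⊆ φ.vars :=
  vars_sum_C_mul_subset δ _ φ.vars_f_subset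

theorem vars_combG_subset (φ : IneqSystem n) (η : Fin φ.s → ℝ) : (φ.combG η).vars ⊆ φ.vars :=
  vars_sum_C_mul_subset η _ φ.vars_g_subset

theorem eval_combF_nonneg {φ : IneqSystem n} {x : Fin n → ℝ} (hx : φ.toFormula.Holds x)
    {δ : Fin φ.r → ℝ} (hδ : ∀ i, 0 ≤ δ i) : 0 ≤ eval x (φ.combF δ) := by
  simp only [combF, map_sum, map_mul, eval_C]
  exact Finset.sum_nonneg fun i _ => mul_nonneg (hδ i) (((φ.holds_iff x).1 hx).1 i)

theorem eval_combG_nonneg {φ : IneqSystem n} {x : Fin n → ℝ} (hx : φ.toFormula.Holds x)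
    {η : Fin φ.s → ℝ} (hη : ∀ j, 0 ≤ η j) : 0 ≤ eval x (φ.combG η) := by
  simp only [combG, map_sum, map_mul, eval_C]
  exact Finset.sum_nonneg fun j _ => mul_nonneg (hη j) (((φ.holds_iff x).1 hx).2 j).le

theorem eval_combG_pos {φ : IneqSystem n} {x : Fin n → ℝ} (hx : φ.toFormula.Holds x)
    {η : Fin φ.s → ℝ} (hη : ∀ j, 0 ≤ η j) (hpos : 0 < ∑ j, η j) : 0 < eval x (φ.combG η) := by
  simp only [combG, map_sum, map_mul, eval_C]
  obtain ⟨j, hj, hj'⟩ := Finset.exists_lt_of_sum_lt (s := Finset.univ) (f := fun _ => (0 : ℝ))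
    (g := η) (by simpa using hpos)
  exact Finset.sum_pos' (fun j _ => mul_nonneg (hη j) (((φ.holds_iff x).1 hx).2 j).le)
    ⟨j, hj, mul_pos hj' (((φ.holds_iff x).1 hx).2 j)⟩

theorem holds_subst_iff (φ : IneqSystem n) (σ : Fin n → MvPolynomial (Fin n) ℝ)
    (x : Fin n → ℝ) :
    (φ.subst σ).toFormula.Holds x ↔ φ.toFormula.Holds fun v => eval x (σ v) := by
  simp only [holds_iff, subst, eval_bind₁_apply]

theorem holds_congr {φ : IneqSystem n} {x y : Fin n → ℝ} (h : ∀ v ∈ φ.vars, x v = y v) :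
    φ.toFormula.Holds x ↔ φ.toFormula.Holds y := by
  have h1 : ∀ i, eval x (φ.f i) = eval y (φ.f i) := fun i =>
    eval_congr_vars fun v hv => h v (φ.vars_f_subset i hv)
  have h2 : ∀ j, eval x (φ.g j) = eval y (φ.g j) := fun j =>
    eval_congr_vars fun v hv => h v (φ.vars_g_subset j hv)
  simp only [holds_iff, h1, h2]

theorem vars_subst_subset (φ : IneqSystem n) {σ : Fin n → MvPolynomial (Fin n) ℝ}
    {S : Finset (Fin n)} (h : ∀ v ∈ φ.vars, (σ v).vars ⊆ S) : (φ.subst σ).vars ⊆ S := by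
  intro w hw
  rcases ((φ.subst σ).mem_vars_iff w).1 hw with ⟨i, hi⟩ | ⟨j, hj⟩
  · obtain ⟨v, hv, hvw⟩ := mem_vars_bind₁ _ _ hi
    exact h v (φ.vars_f_subset i hv) hvw
  · obtain ⟨v, hv, hvw⟩ := mem_vars_bind₁ _ _ hj
    exact h v (φ.vars_g_subset j hv) hvw

theorem IsCQ.subst {φ : IneqSystem n} (hφ : φ.IsCQ) {σ : Fin n → MvPolynomial (Fin n) ℝ}
    (hσ : ∀ v, (σ v).totalDegree ≤ 1) : (φ.subst σ).IsCQ :=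
  ⟨fun i => (hφ.1 i).bind₁ hσ, fun j => (hφ.2 j).bind₁ hσ⟩

theorem Contradictory.subst {φ ψ : IneqSystem n} (h : φ.Contradictory ψ)
    (σ : Fin n → MvPolynomial (Fin n) ℝ) : (φ.subst σ).Contradictory (ψ.subst σ) :=
  fun x hx => h (fun v => eval x (σ v)) ⟨(φ.holds_subst_iff σ x).1 hx.1, (ψ.holds_subst_iff σ x).1 hx.2⟩

theorem isCQ_absurd (n : ℕ) : (absurd n).IsCQ :=
  ⟨fun _ => isConcaveQuadratic_zero, fun _ => isConcaveQuadratic_zero⟩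

theorem not_holds_absurd (x : Fin n → ℝ) : ¬ (absurd n).toFormula.Holds x := by
  rw [holds_iff]
  rintro ⟨-, h⟩
  have := h (⟨0, Nat.one_pos⟩ : Fin 1)
  simp [absurd] at this

theorem vars_absurd (n : ℕ) : (absurd n).vars = ∅ := by
  ext v
  rw [mem_vars_iff]
  simp [absurd]

end IneqSystem

/-! ### Splittings of sums of squares -/

section Splitting

variable {n : ℕ}

theorem commonVars_comm (φ ψ : IneqSystem n) : commonVars φ ψ = commonVars ψ φ :=
  Finset.inter_comm _ _

theorem IsSplitting.symm {φ ψ : IneqSystem n} {h : MvPolynomial (Fin n) ℝ} {a : Fin n → ℝ}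
    {a₀ : ℝ} {l : Fin n → MvPolynomial (Fin n) ℝ} (hs : IsSplitting φ ψ h a a₀ l) :
    IsSplitting ψ φ h a a₀ l where
  a_nonneg := by rw [Finset.union_comm]; exact hs.a_nonneg
  a₀_nonneg := hs.a₀_nonneg
  affine := by rw [Finset.union_comm]; exact hs.affine
  vars_left := by rw [commonVars_comm]; exact hs.vars_right
  vars_right := by rw [commonVars_comm]; exact hs.vars_left
  vars_common := by rw [commonVars_comm]; exact hs.vars_common
  eq_add := by rw [add_comm]; exact hs.eq_add

/-- The order of elimination: local variables precede common ones. -/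
noncomputable def eliminationKey (φ ψ : IneqSystem n) (v : Fin n) : ℕ :=
  v + if v ∈ commonVars φ ψ then n else 0

theorem eliminationKey_comm (φ ψ : IneqSystem n) :
    eliminationKey φ ψ = eliminationKey ψ φ := by
  funext v
  simp only [eliminationKey, commonVars_comm φ ψ]

theorem eliminationKey_injective (φ ψ : IneqSystem n) :
    Function.Injective (eliminationKey φ ψ) := by
  intro v w h
  unfold eliminationKey at h
  ext
  split_ifs at h <;> omega

theorem eliminationKey_lt (φ ψ : IneqSystem n) (v : Fin n) : eliminationKey φ ψ v < 2 * n := by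
  unfold eliminationKey
  split_ifs <;> omega

/-- This merges the separate variable conditions into one triangularity statement per side; the
ψ-side follows by `IsSplitting.symm`. All later inductions on elimination rest on it. -/
theorem IsSplitting.mem_of_mem_vars {φ ψ : IneqSystem n} {h : MvPolynomial (Fin n) ℝ}
    {a : Fin n → ℝ} {a₀ : ℝ} {l : Fin n → MvPolynomial (Fin n) ℝ}
    (hs : IsSplitting φ ψ h a a₀ l) {v w : Fin n} (hv : v ∈ φ.vars) (hw : w ∈ (l v).vars) :
    w ∈ φ.vars ∧ eliminationKey φ ψ v < eliminationKey φ ψ w := by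
  by_cases hψ : v ∈ ψ.vars
  · have hc : v ∈ commonVars φ ψ := Finset.mem_inter.2 ⟨hv, hψ⟩
    have := Finset.mem_filter.1 (hs.vars_common v hc hw)
    refine ⟨(Finset.mem_inter.1 this.1).1, ?_⟩
    simp only [eliminationKey, hc, this.1, if_true]
    have := this.2
    omega
  · have hl : v ∈ localVars φ ψ := Finset.mem_sdiff.2 ⟨hv, hψ⟩
    have hnc : v ∉ commonVars φ ψ := fun h => hψ (Finset.mem_inter.1 h).2
    rcases Finset.mem_union.1 (hs.vars_left v hl hw) with h1 | h1
    · refine ⟨(Finset.mem_inter.1 h1).1, ?_⟩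
      simp only [eliminationKey, hnc, h1, if_true, if_false]
      omega
    · have h2 := Finset.mem_filter.1 h1
      have h3 := Finset.mem_sdiff.1 h2.1
      have hnw : w ∉ commonVars φ ψ := fun h => h3.2 (Finset.mem_inter.1 h).2
      refine ⟨h3.1, ?_⟩
      simp only [eliminationKey, hnc, hnw, if_false]
      have := h2.2
      omega

theorem isSumSq_C_mul_sq {a : ℝ} (ha : 0 ≤ a) (p : MvPolynomial (Fin n) ℝ) :
    IsSumSq (C a * p ^ 2) := by
  have : C a * p ^ 2 = (C (Real.sqrt a) * p) * (C (Real.sqrt a) * p) := by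
    rw [mul_mul_mul_comm, ← C_mul, Real.mul_self_sqrt ha, sq]
  rw [this]
  exact IsSumSq.mul_self _

theorem eval_nonneg_of_isSumSq {p : MvPolynomial (Fin n) ℝ} (hp : IsSumSq p) (x : Fin n → ℝ) :
    0 ≤ eval x p := by
  induction hp with
  | zero => simp
  | sq_add q _ ih =>
    rw [map_add, map_mul]
    exact add_nonneg (mul_self_nonneg _) ih

theorem squarePart_eq (φ ψ : IneqSystem n) (a : Fin n → ℝ) (a₀ : ℝ)
    (l : Fin n → MvPolynomial (Fin n) ℝ) :
    squarePart φ ψ a a₀ l = ∑ v ∈ φ.vars,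
      C (if v ∈ ψ.vars then 1 / 2 * a v else a v) * (X v - l v) ^ 2 + C (a₀ / 2) := by
  rw [squarePart, squareSum, squareSum, localVars, commonVars,
    ← Finset.sum_sdiff (Finset.inter_subset_left : φ.vars ∩ ψ.vars ⊆ φ.vars),
    Finset.sdiff_inter_self_left, Finset.mul_sum]
  congr 2
  · refine Finset.sum_congr rfl fun v hv => ?_
    rw [if_neg (Finset.mem_sdiff.1 hv).2]
  · refine Finset.sum_congr rfl fun v hv => ?_
    rw [if_pos (Finset.mem_inter.1 hv).2, C_mul, mul_assoc]

namespace IsSplitting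

variable {φ ψ : IneqSystem n} {h : MvPolynomial (Fin n) ℝ} {a : Fin n → ℝ}
  {a₀ : ℝ} {l : Fin n → MvPolynomial (Fin n) ℝ}

theorem coeff_nonneg (hs : IsSplitting φ ψ h a a₀ l) {v : Fin n} (hv : v ∈ φ.vars) :
    0 ≤ if v ∈ ψ.vars then 1 / 2 * a v else a v := by
  have := hs.a_nonneg v (Finset.mem_union_left _ hv)
  split_ifs
  · linarith
  · exact this

theorem isSumSq_squarePart (hs : IsSplitting φ ψ h a a₀ l) :
    IsSumSq (squarePart φ ψ a a₀ l) := by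
  rw [squarePart_eq]
  refine IsSumSq.add (IsSumSq.sum fun v hv => isSumSq_C_mul_sq (hs.coeff_nonneg hv) _) ?_
  have := isSumSq_C_mul_sq (n := n) (div_nonneg hs.a₀_nonneg zero_le_two) 1
  rwa [one_pow, mul_one] at this

theorem vars_squarePart_subset (hs : IsSplitting φ ψ h a a₀ l) :
    (squarePart φ ψ a a₀ l).vars ⊆ φ.vars := by
  rw [squarePart_eq]
  intro w hw
  rcases Finset.mem_union.1 (vars_add_subset _ _ hw) with h1 | h1
  · obtain ⟨v, hv, h2⟩ := Finset.mem_biUnion.1 (vars_sum_subset _ _ h1)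
    have h3 := vars_mul _ _ h2
    rw [vars_C, Finset.empty_union] at h3
    rcases Finset.mem_union.1 (vars_sub_subset _ (vars_pow _ _ h3)) with h4 | h4
    · rw [vars_X, Finset.mem_singleton] at h4
      exact h4 ▸ hv
    · exact (hs.mem_of_mem_vars hv h4).1
  · simp at h1

theorem eval_squarePart_ge (hs : IsSplitting φ ψ h a a₀ l) (x : Fin n → ℝ) :
    a₀ / 2 ≤ eval x (squarePart φ ψ a a₀ l) := by
  rw [squarePart_eq]
  simp only [map_add, map_sum, map_mul, eval_C, map_pow]
  exact le_add_of_nonneg_left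
    (Finset.sum_nonneg fun v hv => mul_nonneg (hs.coeff_nonneg hv) (sq_nonneg _))

/-- All summands are nonnegative, so each vanishes. Half of a positive weight is still positive, so
either side alone forces the equations of the common variables. -/
theorem eq_of_eval_squarePart_eq_zero (hs : IsSplitting φ ψ h a a₀ l) {x : Fin n → ℝ}
    (hx : eval x (squarePart φ ψ a a₀ l) = 0) {v : Fin n} (hv : v ∈ φ.vars) (ha : 0 < a v) :
    x v = eval x (l v) := by
  rw [squarePart_eq] at hx
  simp only [map_add, map_sum, map_mul, eval_C, map_pow, map_sub, eval_X] at hx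
  have hnn : ∀ w ∈ φ.vars,
      0 ≤ (if w ∈ ψ.vars then 1 / 2 * a w else a w) * (x w - eval x (l w)) ^ 2 :=
    fun w hw => mul_nonneg (hs.coeff_nonneg hw) (sq_nonneg _)
  have h0 := hs.a₀_nonneg
  have hsum := Finset.sum_nonneg hnn
  have h1 := (Finset.sum_eq_zero_iff_of_nonneg hnn).1 (by linarith) v hv
  have h2 : (if v ∈ ψ.vars then 1 / 2 * a v else a v) ≠ 0 := by
    split_ifs
    · linarith
    · exact ha.ne'
  have h3 := (mul_eq_zero.1 h1).resolve_left h2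
  exact sub_eq_zero.1 (pow_eq_zero_iff two_ne_zero |>.1 h3)

end IsSplitting

/-- Completing squares splits a nonnegative quadratic polynomial without products of local
variables of `φ` and local variables of `ψ`. -/
theorem IsPSDForm.exists_isSplitting (φ ψ : IneqSystem n)
    {H : Option (Fin n) → Option (Fin n) → ℝ} (hH : IsPSDForm H)
    (hR : ∀ v w, H (some v) (some w) ≠ 0 →
      (v ∈ φ.vars ∧ w ∈ φ.vars) ∨ (v ∈ ψ.vars ∧ w ∈ ψ.vars)) :
    ∃ a a₀ l, IsSplitting φ ψ (quadPoly H) a a₀ l := by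
  classical
  obtain ⟨a, a₀, c, ha, ha₀, haz, hc, hq⟩ := hH.exists_squares (eliminationKey φ ψ)
    (eliminationKey_injective φ ψ)
    -- A local pivot is coupled only with variables of its own side, so fill-in stays on that side.
    -- After a common pivot only common variables have larger key.
    (fun v w => (v ∈ φ.vars ∧ w ∈ φ.vars) ∨ (v ∈ ψ.vars ∧ w ∈ ψ.vars)) (by
      intro p v w hpv hpw h1 h2
      simp only [eliminationKey, commonVars, Finset.mem_inter] at hpv hpw
      by_cases hp : p ∈ φ.vars ∧ p ∈ ψ.vars
      · rw [if_pos hp] at hpv hpw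
        have hv : v ∈ φ.vars ∧ v ∈ ψ.vars := by
          by_contra h; rw [if_neg h] at hpv; omega
        have hw : w ∈ φ.vars ∧ w ∈ ψ.vars := by
          by_contra h; rw [if_neg h] at hpw; omega
        exact Or.inl ⟨hv.1, hw.1⟩
      · tauto) H hR
  have hleft : ∀ v w, v ∈ φ.vars → v ∉ ψ.vars → c v (some w) ≠ 0 →
      w ∈ commonVars φ ψ ∪ (localVars φ ψ).filter (v < ·) := by
    intro v w hv hv' h
    obtain ⟨hk, h1⟩ := hc v w h
    have hw : w ∈ φ.vars := by tauto
    by_cases hw' : w ∈ ψ.vars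
    · exact Finset.mem_union_left _ (Finset.mem_inter.2 ⟨hw, hw'⟩)
    · refine Finset.mem_union_right _
        (Finset.mem_filter.2 ⟨Finset.mem_sdiff.2 ⟨hw, hw'⟩, ?_⟩)
      simp only [eliminationKey, commonVars, Finset.mem_inter, hv', hw', and_false, if_false] at hk
      rw [Fin.lt_def]; omega
  have hright : ∀ v w, v ∈ ψ.vars → v ∉ φ.vars → c v (some w) ≠ 0 →
      w ∈ commonVars φ ψ ∪ (localVars ψ φ).filter (v < ·) := by
    intro v w hv hv' h
    obtain ⟨hk, h1⟩ := hc v w h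
    have hw : w ∈ ψ.vars := by tauto
    by_cases hw' : w ∈ φ.vars
    · exact Finset.mem_union_left _ (Finset.mem_inter.2 ⟨hw', hw⟩)
    · refine Finset.mem_union_right _
        (Finset.mem_filter.2 ⟨Finset.mem_sdiff.2 ⟨hw, hw'⟩, ?_⟩)
      simp only [eliminationKey, commonVars, Finset.mem_inter, hv', hw', false_and, if_false] at hk
      rw [Fin.lt_def]; omega
  refine ⟨a, a₀, fun v => affinePoly (c v), fun v _ => ha v, ha₀,
    fun v _ => totalDegree_affinePoly_le _, ?_, ?_, ?_, ?_⟩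
  · intro v hv
    rw [localVars, Finset.mem_sdiff] at hv
    exact vars_affinePoly_subset _ fun w hw => hleft v w hv.1 hv.2 hw
  · intro v hv
    rw [localVars, Finset.mem_sdiff] at hv
    exact vars_affinePoly_subset _ fun w hw => hright v w hv.1 hv.2 hw
  · intro v hv
    refine vars_affinePoly_subset _ fun w hw => ?_
    obtain ⟨hk, -⟩ := hc v w hw
    simp only [eliminationKey, hv, if_true] at hk
    have hwc : w ∈ commonVars φ ψ := by
      by_contra h; rw [if_neg h] at hk; omega
    rw [if_pos hwc] at hk
    refine Finset.mem_filter.2 ⟨hwc, ?_⟩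
    rw [Fin.lt_def]; omega
  · refine MvPolynomial.funext fun x => ?_
    -- A variable in neither system has a zero diagonal entry, so the sum over all variables reduces
    -- to the two sides.
    have hz : ∀ v, v ∉ φ.vars → v ∉ ψ.vars → a v = 0 := fun v h1 h2 => by
      refine haz v ?_
      by_contra h
      have := hR v v h
      tauto
    rw [eval_quadPoly, hq, squarePart_eq, squarePart_eq]
    simp only [map_add, map_sum, map_mul, eval_C, map_pow, map_sub, eval_X, homog_some, homog_none,
      eval_affinePoly]
    rw [← Finset.univ_inter φ.vars, ← Finset.univ_inter ψ.vars, ← Finset.sum_ite_mem,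
      ← Finset.sum_ite_mem, Finset.univ_inter, Finset.univ_inter]
    have : ∀ v, a v * (x v - ∑ k, c v k * homog x k) ^ 2 =
        (if v ∈ φ.vars then (if v ∈ ψ.vars then 1 / 2 * a v else a v) *
          (x v - ∑ k, c v k * homog x k) ^ 2 else 0) +
        (if v ∈ ψ.vars then (if v ∈ φ.vars then 1 / 2 * a v else a v) *
          (x v - ∑ k, c v k * homog x k) ^ 2 else 0) := by
      intro v
      by_cases h1 : v ∈ φ.vars <;> by_cases h2 : v ∈ ψ.vars
      · simp only [h1, h2, if_true]; ring
      · simp [h1, h2]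
      · simp [h1, h2]
      · simp [h1, h2, hz v h1 h2]
    rw [Finset.sum_congr rfl fun v _ => this v, Finset.sum_add_distrib]
    ring

end Splitting

/-! ### Solvability of the base case -/

section BaseCase

variable {n : ℕ}

/-- Symmetric matrices of concave quadratic polynomials in the variables `S`. -/
def concaveForms (S : Finset (Fin n)) : Set (Option (Fin n) → Option (Fin n) → ℝ) :=
  {M | (∀ i j, M i j = M j i) ∧ (∀ u, u none = 0 → quadValue M u ≤ 0) ∧
    ∀ v ∉ S, ∀ j, M (some v) j = 0}

theorem add_mem_concaveForms {S : Finset (Fin n)} {M N : Option (Fin n) → Option (Fin n) → ℝ}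
    (hM : M ∈ concaveForms S) (hN : N ∈ concaveForms S) : M + N ∈ concaveForms S :=
  ⟨fun i j => by simp only [Pi.add_apply, hM.1 i j, hN.1 i j],
    fun u hu => by rw [quadValue_add]; exact add_nonpos (hM.2.1 u hu) (hN.2.1 u hu),
    fun v hv j => by simp only [Pi.add_apply, hM.2.2 v hv j, hN.2.2 v hv j, add_zero]⟩

theorem smul_mem_concaveForms {S : Finset (Fin n)} {M : Option (Fin n) → Option (Fin n) → ℝ}
    (hM : M ∈ concaveForms S) {c : ℝ} (hc : 0 ≤ c) : c • M ∈ concaveForms S :=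
  ⟨fun i j => by simp only [Pi.smul_apply, hM.1 i j],
    fun u hu => by
      rw [quadValue_smul]; exact mul_nonpos_of_nonneg_of_nonpos hc (hM.2.1 u hu),
    fun v hv j => by simp only [Pi.smul_apply, hM.2.2 v hv j, smul_zero]⟩

theorem zero_mem_concaveForms (S : Finset (Fin n)) : 0 ∈ concaveForms S :=
  ⟨fun _ _ => rfl, fun u _ => (quadValue_zero u).le, fun _ _ _ => rfl⟩

theorem sum_smul_mem_concaveForms {S : Finset (Fin n)} {κ : Type*} [Fintype κ] {δ : κ → ℝ}
    (hδ : ∀ k, 0 ≤ δ k) {M : κ → Option (Fin n) → Option (Fin n) → ℝ}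
    (hM : ∀ k, M k ∈ concaveForms S) : ∑ k, δ k • M k ∈ concaveForms S :=
  Finset.sum_induction _ (· ∈ concaveForms S) (fun _ _ => add_mem_concaveForms)
    (zero_mem_concaveForms S) fun k _ => smul_mem_concaveForms (hM k) (hδ k)

theorem quadValue_unitForm (u : Option (Fin n) → ℝ) :
    quadValue (unitForm none none) u = u none ^ 2 := by
  simp [quadValue, unitForm, Fintype.sum_option]
  ring

theorem unitForm_mem_concaveForms (S : Finset (Fin n)) : unitForm none none ∈ concaveForms S :=
  ⟨fun i j => by simp only [unitForm, and_comm], fun u hu => by simp [quadValue_unitForm, hu],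
    fun v _ j => by simp [unitForm]⟩

theorem IsConcaveQuadratic.exists_mem_concaveForms {p : MvPolynomial (Fin n) ℝ}
    (hp : IsConcaveQuadratic p) {S : Finset (Fin n)} (hS : p.vars ⊆ S) :
    ∃ M ∈ concaveForms S, p = quadPoly M := by
  obtain ⟨M, h1, h2, h3, h4⟩ := hp.exists_form
  exact ⟨M, ⟨h1, h2, fun v hv => h3 v fun h => hv (hS h)⟩, h4⟩

/-- The opposite of the sum of a concave quadratic polynomial in the variables of `φ` and one in
the variables of `ψ` has a splitting if it is nonnegative. -/
theorem exists_isSplitting_of_nonneg (φ ψ : IneqSystem n)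
    {M N : Option (Fin n) → Option (Fin n) → ℝ} (hM : M ∈ concaveForms φ.vars)
    (hN : N ∈ concaveForms ψ.vars) (h : ∀ x, 0 ≤ eval x (-(quadPoly M + quadPoly N))) :
    ∃ a a₀ l, IsSplitting φ ψ (-(quadPoly M + quadPoly N)) a a₀ l := by
  have he : -(quadPoly M + quadPoly N) = quadPoly (-(M + N)) := by
    rw [quadPoly_neg, quadPoly_add]
  rw [he] at h ⊢
  have hH : IsPSDForm (-(M + N)) := by
    refine isPSDForm_of_eval_nonneg (fun i j => ?_) (fun u hu => ?_) h
    · simp only [Pi.neg_apply, Pi.add_apply, hM.1 i j, hN.1 i j]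
    · rw [quadValue_neg, quadValue_add]
      have := hM.2.1 u hu
      have := hN.2.1 u hu
      linarith
  -- A nonzero entry of `M + N` comes from `M` or from `N`, so both of its variables belong to the
  -- same system.
  refine hH.exists_isSplitting φ ψ fun v w hvw => ?_
  by_contra hcon
  apply hvw
  have h1 : M (some v) (some w) = 0 := by
    by_cases hv : v ∈ φ.vars
    · rw [hM.1]; exact hM.2.2 w (fun hw => hcon (Or.inl ⟨hv, hw⟩)) _
    · exact hM.2.2 v hv _
  have h2 : N (some v) (some w) = 0 := by
    by_cases hv : v ∈ ψ.vars
    · rw [hN.1]; exact hN.2.2 w (fun hw => hcon (Or.inr ⟨hv, hw⟩)) _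
    · exact hN.2.2 v hv _
  simp [h1, h2]

theorem IneqSystem.IsCQ.exists_combF {φ : IneqSystem n} (hφ : φ.IsCQ) :
    ∃ F : Fin φ.r → Option (Fin n) → Option (Fin n) → ℝ,
      (∀ i, F i ∈ concaveForms φ.vars) ∧ (∀ i, φ.f i = quadPoly (F i)) ∧
      ∀ δ, φ.combF δ = quadPoly (∑ i, δ i • F i) := by
  choose F hF hF' using fun i => (hφ.1 i).exists_mem_concaveForms (φ.vars_f_subset i)
  refine ⟨F, hF, hF', fun δ => ?_⟩
  rw [quadPoly_sum_smul, combF]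
  exact Finset.sum_congr rfl fun i _ => by rw [hF' i]

theorem IneqSystem.IsCQ.exists_combG {φ : IneqSystem n} (hφ : φ.IsCQ) :
    ∃ G : Fin φ.s → Option (Fin n) → Option (Fin n) → ℝ,
      (∀ j, G j ∈ concaveForms φ.vars) ∧ (∀ j, φ.g j = quadPoly (G j)) ∧
      ∀ η, φ.combG η = quadPoly (∑ j, η j • G j) := by
  choose G hG hG' using fun j => (hφ.2 j).exists_mem_concaveForms (φ.vars_g_subset j)
  refine ⟨G, hG, hG', fun η => ?_⟩
  rw [quadPoly_sum_smul, combG]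
  exact Finset.sum_congr rfl fun j _ => by rw [hG' j]

/-- The theorem of the alternative in the space of matrices. The semidefinite remainder of a
combination splits into h₁ and h₂; a separating functional would contradict the inconsistency of φ ∧
ψ. -/
theorem exists_IGFCHReturns {φ ψ : IneqSystem n} (hφ : φ.IsCQ) (hψ : ψ.IsCQ)
    (hcontra : φ.Contradictory ψ) (hN : NSOSC φ ψ) : ∃ I, IGFCHReturns φ ψ I := by
  obtain ⟨F, hF, hFf, hFc⟩ := hφ.exists_combF
  obtain ⟨F', hF', hFf', hFc'⟩ := hψ.exists_combF
  obtain ⟨G, hG, hGg, hGc⟩ := hφ.exists_combG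
  obtain ⟨G', hG', hGg', hGc'⟩ := hψ.exists_combG
  -- The constant 1 joins the strict inequalities as index `none`. Its coefficient is η₀, and in the
  -- other alternative it gives the functional positive mass.
  rcases exists_combination_or_functional (V := Option (Fin n) → Option (Fin n) → ℝ)
    (Sum.elim F F') (fun k : Option (Fin φ.s ⊕ Fin ψ.s) => k.elim (unitForm none none)
      (Sum.elim G G')) (P := {M | IsPSDForm M}) isClosed_isPSDForm IsPSDForm.zero
    (fun x hx y hy => IsPSDForm.add hx hy) (fun c hc x hx => IsPSDForm.smul hx hc)
    (by
      -- NSOSC enters here, as the closedness hypothesis: a nonzero `p` would, once split, be a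
      -- forbidden nonzero sum of squares.
      intro δ hδ p hp h
      refine IsPSDForm.eq_zero_of_quadPoly hp ?_
      by_contra hne
      set M := ∑ i, δ (Sum.inl i) • F i with hM
      set N := ∑ i, δ (Sum.inr i) • F' i with hNdef
      have hp' : quadPoly p = -(quadPoly M + quadPoly N) := by
        rw [← quadPoly_add, ← quadPoly_neg]
        congr 1
        rw [Fintype.sum_sum_type] at h
        exact eq_neg_of_add_eq_zero_right h
      obtain ⟨a, a₀, l, hs⟩ := exists_isSplitting_of_nonneg φ ψ
        (sum_smul_mem_concaveForms (fun i => hδ (Sum.inl i)) hF)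
        (sum_smul_mem_concaveForms (fun i => hδ (Sum.inr i)) hF')
        (fun x => by rw [← hp', eval_quadPoly]; exact hp.2 _)
      refine hN ⟨fun i => δ (Sum.inl i), fun i => δ (Sum.inr i), fun i => hδ _, fun i => hδ _, ?_⟩
      rw [hFc, hFc', ← hM, ← hNdef]
      refine ⟨?_, hp' ▸ hne⟩
      rw [hs.eq_add]
      exact hs.isSumSq_squarePart.add hs.symm.isSumSq_squarePart)
    with ⟨lam, η, hlam, hη, hsum, hP⟩ | ⟨L, hLP, hLf, hLg⟩
  · set M := ∑ i, lam (Sum.inl i) • F i + ∑ j, η (some (Sum.inl j)) • G j +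
      η none • unitForm none none with hM
    set N := ∑ i, lam (Sum.inr i) • F' i + ∑ j, η (some (Sum.inr j)) • G' j with hNdef
    have hMc : M ∈ concaveForms φ.vars := add_mem_concaveForms (add_mem_concaveForms
      (sum_smul_mem_concaveForms (fun i => hlam _) hF)
      (sum_smul_mem_concaveForms (fun i => hη _) hG))
      (smul_mem_concaveForms (unitForm_mem_concaveForms _) (hη _))
    have hNc : N ∈ concaveForms ψ.vars := add_mem_concaveForms
      (sum_smul_mem_concaveForms (fun i => hlam _) hF')
      (sum_smul_mem_concaveForms (fun i => hη _) hG')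
    have hMN : -(M + N) ∈ {M | IsPSDForm M} := by
      refine Set.mem_of_eq_of_mem (congrArg Neg.neg ?_) hP
      rw [Fintype.sum_sum_type, Fintype.sum_option, Fintype.sum_sum_type, hM, hNdef]
      simp only [Sum.elim_inl, Sum.elim_inr, Option.elim]
      abel
    have hMp : quadPoly M = φ.combF (fun i => lam (Sum.inl i)) +
        φ.combG (fun j => η (some (Sum.inl j))) + C (η none) := by
      rw [hM, quadPoly_add, quadPoly_add, ← hFc, ← hGc]
      congr 1
      refine MvPolynomial.funext fun x => ?_
      rw [eval_quadPoly, quadValue_smul, quadValue_unitForm]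
      simp
    have hNp : quadPoly N = ψ.combF (fun i => lam (Sum.inr i)) +
        ψ.combG (fun j => η (some (Sum.inr j))) := by
      rw [hNdef, quadPoly_add, ← hFc', ← hGc']
    obtain ⟨a, a₀, l, hs⟩ := exists_isSplitting_of_nonneg φ ψ hMc hNc (fun x => by
      rw [← quadPoly_add, ← quadPoly_neg, eval_quadPoly]; exact hMN.2 _)
    have hadd := hs.eq_add
    rw [hMp, hNp] at hadd
    classical
    refine ⟨if 0 < η none + ∑ j, η (some (Sum.inl j)) then .gt _ else .ge _,
      .intro (fun i => lam (Sum.inl i)) (fun i => lam (Sum.inr i)) (η none)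
        (fun j => η (some (Sum.inl j))) (fun j => η (some (Sum.inr j)))
        (squarePart φ ψ a a₀ l) (squarePart ψ φ a a₀ l) _ _ (fun _ => hlam _) (fun _ => hlam _)
        (hη _) (fun _ => hη _) (fun _ => hη _) hs.isSumSq_squarePart hs.symm.isSumSq_squarePart
        hs.vars_squarePart_subset hs.symm.vars_squarePart_subset ?_ ?_ rfl
        (fun h => if_pos h) (fun h => if_neg h)⟩
    · rw [add_assoc, ← hadd]
      ring
    · rw [Fintype.sum_option, Fintype.sum_sum_type] at hsum
      rw [← hsum, add_assoc]
  · exfalso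
    obtain ⟨x, hx⟩ := exists_barycentre L.toLinearMap hLP (hLg none)
    have hpos : 0 < L (unitForm none none) := hLg none
    -- Jensen's inequality with positive mass: the sign of `L M` passes to the value at the
    -- barycentre.
    have hge : ∀ {S : Finset (Fin n)} {M : Option (Fin n) → Option (Fin n) → ℝ},
        M ∈ concaveForms S → 0 ≤ L M → 0 ≤ eval x (quadPoly M) := fun hM h =>
      nonneg_of_mul_nonneg_right (h.trans (hx _ hM.1 hM.2.1)) hpos
    have hgt : ∀ {S : Finset (Fin n)} {M : Option (Fin n) → Option (Fin n) → ℝ},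
        M ∈ concaveForms S → 0 < L M → 0 < eval x (quadPoly M) := fun hM h =>
      (mul_pos_iff_of_pos_left hpos).1 (h.trans_le (hx _ hM.1 hM.2.1))
    refine hcontra x ⟨(φ.holds_iff x).2 ⟨fun i => ?_, fun j => ?_⟩,
      (ψ.holds_iff x).2 ⟨fun i => ?_, fun j => ?_⟩⟩
    · rw [hFf]; exact hge (hF i) (hLf (Sum.inl i))
    · rw [hGg]; exact hgt (hG j) (hLg (some (Sum.inl j)))
    · rw [hFf']; exact hge (hF' i) (hLf (Sum.inr i))
    · rw [hGg']; exact hgt (hG' j) (hLg (some (Sum.inr j)))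

/-- The identity rewrites p as minus an expression over ψ, which bounds its variables and its sign
on ψ. The normalization puts positive strict weight on the ψ-side exactly when the φ-side has none,
so one of the two bounds is strict. -/
theorem IGFCHReturns.isInterpolant {φ ψ : IneqSystem n} {I : PolyFormula n}
    (h : IGFCHReturns φ ψ I) : I.IsInterpolant φ.toFormula ψ.toFormula := by
  obtain ⟨lam, lam', η₀, η, η', h₁, h₂, p, _, hlam, hlam', hη₀, hη, hη', sos₁, sos₂, vars₁, vars₂,
    identity, normalized, hp, strict, nonstrict⟩ := h
  have hp' : p = -(ψ.combF lam' + ψ.combG η' + h₂) := by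
    rw [hp, eq_neg_iff_add_eq_zero, ← identity]; ring
  have hpφ : p.vars ⊆ φ.vars := by
    rw [hp]
    refine (vars_add_subset _ _).trans (Finset.union_subset ((vars_add_subset _ _).trans
      (Finset.union_subset ((vars_add_subset _ _).trans (Finset.union_subset
        (φ.vars_combF_subset _) (φ.vars_combG_subset _))) ?_)) vars₁)
    simp
  have hpψ : p.vars ⊆ ψ.vars := by
    rw [hp', vars_neg]
    exact (vars_add_subset _ _).trans (Finset.union_subset ((vars_add_subset _ _).trans
      (Finset.union_subset (ψ.vars_combF_subset _) (ψ.vars_combG_subset _))) vars₂)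
  have hpv : p.vars ⊆ φ.vars ∩ ψ.vars := Finset.subset_inter hpφ hpψ
  by_cases hs : 0 < η₀ + ∑ j, η j
  · rw [strict hs]
    refine ⟨fun x hx => ?_, fun x hx => ?_, hpv⟩
    · have h1 := IneqSystem.eval_combF_nonneg hx hlam
      have h2 := IneqSystem.eval_combG_nonneg hx hη
      have h3 := eval_nonneg_of_isSumSq sos₁ x
      simp only [PolyFormula.Holds, hp, map_add, eval_C]
      rcases hη₀.eq_or_lt with h0 | h0
      · rw [← h0, zero_add] at hs
        have := IneqSystem.eval_combG_pos hx hη hs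
        linarith
      · linarith
    · have h0 : 0 < eval x p := hx.1
      have h1 := IneqSystem.eval_combF_nonneg hx.2 hlam'
      have h2 := IneqSystem.eval_combG_nonneg hx.2 hη'
      have h3 := eval_nonneg_of_isSumSq sos₂ x
      simp only [hp', map_add, map_neg] at h0
      exact absurd h0 (by linarith)
  · rw [nonstrict hs]
    refine ⟨fun x hx => ?_, fun x hx => ?_, hpv⟩
    · have h1 := IneqSystem.eval_combF_nonneg hx hlam
      have h2 := IneqSystem.eval_combG_nonneg hx hη
      have h3 := eval_nonneg_of_isSumSq sos₁ x
      simp only [PolyFormula.Holds, hp, map_add, eval_C]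
      linarith
    · have h0 : 0 ≤ eval x p := hx.1
      have h1 := IneqSystem.eval_combF_nonneg hx.2 hlam'
      have h2 := IneqSystem.eval_combG_pos hx.2 hη' (by linarith)
      have h3 := eval_nonneg_of_isSumSq sos₂ x
      simp only [hp', map_add, map_neg] at h0
      exact absurd h0 (by linarith)

end BaseCase

/-! ### Eliminations -/

section Elimination

variable {n : ℕ}

theorem totalDegree_bind₁_le_one {p : MvPolynomial (Fin n) ℝ} (hp : p.totalDegree ≤ 1)
    {σ : Fin n → MvPolynomial (Fin n) ℝ} (hσ : ∀ v, (σ v).totalDegree ≤ 1) :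
    (bind₁ σ p).totalDegree ≤ 1 := by
  obtain ⟨c, rfl⟩ := exists_eq_affinePoly hp
  rw [affinePoly, map_sum]
  refine totalDegree_finsetSum_le fun k _ => ?_
  rw [map_mul, bind₁_C_right]
  refine (totalDegree_mul _ _).trans ?_
  rw [totalDegree_C, zero_add]
  cases k with
  | none => simp
  | some v => simpa using hσ v

theorem bind₁_congr_vars {σ τ : Fin n → MvPolynomial (Fin n) ℝ} {p : MvPolynomial (Fin n) ℝ}
    (h : ∀ v ∈ p.vars, σ v = τ v) : bind₁ σ p = bind₁ τ p :=
  eval₂Hom_congr' rfl (fun v hv _ => h v hv) rfl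

theorem eliminatedVars_comm (φ ψ : IneqSystem n) (a : Fin n → ℝ) :
    eliminatedVars φ ψ a = eliminatedVars ψ φ a := by
  rw [eliminatedVars, eliminatedVars, Finset.union_comm]

theorem IsElimination.symm {φ ψ : IneqSystem n} {a : Fin n → ℝ}
    {l σ : Fin n → MvPolynomial (Fin n) ℝ} (hσ : IsElimination φ ψ a l σ) :
    IsElimination ψ φ a l σ where
  fixed := by rw [eliminatedVars_comm]; exact hσ.fixed
  affine := hσ.affine
  vars_left := by rw [eliminatedVars_comm]; exact hσ.vars_right
  vars_right := by rw [eliminatedVars_comm]; exact hσ.vars_left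
  solves := by rw [eliminatedVars_comm]; exact hσ.solves

/-- Back substitution in the triangular system `v = l_v`, `v` eliminated. -/
noncomputable def backSubstitution (φ ψ : IneqSystem n) (a : Fin n → ℝ)
    (l : Fin n → MvPolynomial (Fin n) ℝ) (v : Fin n) : MvPolynomial (Fin n) ℝ :=
  open Classical in
  if v ∈ eliminatedVars φ ψ a then
    -- The guard serves termination only: for a splitting, every variable of `l v` has larger key
    -- and the default 0 is never used.
    bind₁ (fun w => if eliminationKey φ ψ v < eliminationKey φ ψ w then
      backSubstitution φ ψ a l w else 0) (l v)
  else X v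
termination_by 2 * n - eliminationKey φ ψ v
decreasing_by
  have := eliminationKey_lt φ ψ w
  omega

variable {φ ψ : IneqSystem n} {h : MvPolynomial (Fin n) ℝ} {a : Fin n → ℝ} {a₀ : ℝ}
  {l σ : Fin n → MvPolynomial (Fin n) ℝ}

theorem eliminationKey_induction (φ ψ : IneqSystem n) {P : Fin n → Prop}
    (ih : ∀ v, (∀ w, eliminationKey φ ψ v < eliminationKey φ ψ w → P w) → P v) (v : Fin n) :
    P v := by
  induction hk : 2 * n - eliminationKey φ ψ v using Nat.strong_induction_on generalizing v with
  | _ k h =>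
    refine ih v fun w hw => h _ ?_ w rfl
    have := eliminationKey_lt φ ψ w
    omega

theorem IsSplitting.backSubstitution_of_mem (hs : IsSplitting φ ψ h a a₀ l) {v : Fin n}
    (hv : v ∈ eliminatedVars φ ψ a) :
    backSubstitution φ ψ a l v = bind₁ (backSubstitution φ ψ a l) (l v) := by
  rw [backSubstitution, if_pos hv]
  refine bind₁_congr_vars fun w hw => if_pos ?_
  rcases Finset.mem_union.1 (Finset.mem_filter.1 hv).1 with h1 | h1
  · exact (hs.mem_of_mem_vars h1 hw).2
  · rw [eliminationKey_comm]
    exact (hs.symm.mem_of_mem_vars h1 hw).2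

theorem backSubstitution_of_notMem {v : Fin n} (hv : v ∉ eliminatedVars φ ψ a) :
    backSubstitution φ ψ a l v = X v := by
  rw [backSubstitution, if_neg hv]

theorem IsSplitting.vars_backSubstitution_subset (hs : IsSplitting φ ψ h a a₀ l)
    {S : Finset (Fin n)} (hS : ∀ v ∈ S, (l v).vars ⊆ S) (v : Fin n) (hv : v ∈ S) :
    (backSubstitution φ ψ a l v).vars ⊆ S \ eliminatedVars φ ψ a := by
  revert hv
  induction v using eliminationKey_induction φ ψ with
  | ih v ih =>
    intro hv
    by_cases he : v ∈ eliminatedVars φ ψ a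
    · rw [hs.backSubstitution_of_mem he]
      intro u hu
      obtain ⟨w, hw, huw⟩ := mem_vars_bind₁ _ _ hu
      refine ih w ?_ (hS v hv hw) huw
      rcases Finset.mem_union.1 (Finset.mem_filter.1 he).1 with h1 | h1
      · exact (hs.mem_of_mem_vars h1 hw).2
      · rw [eliminationKey_comm]
        exact (hs.symm.mem_of_mem_vars h1 hw).2
    · rw [backSubstitution_of_notMem he, vars_X, Finset.singleton_subset_iff]
      exact Finset.mem_sdiff.2 ⟨hv, he⟩

theorem IsSplitting.exists_isElimination (hs : IsSplitting φ ψ h a a₀ l) :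
    ∃ σ, IsElimination φ ψ a l σ := by
  refine ⟨backSubstitution φ ψ a l, fun v hv => backSubstitution_of_notMem hv, fun v => ?_,
    fun v _ => hs.vars_backSubstitution_subset (fun v hv w hw => (hs.mem_of_mem_vars hv hw).1) v,
    fun v _ => hs.vars_backSubstitution_subset
      (fun v hv w hw => (hs.symm.mem_of_mem_vars hv hw).1) v,
    fun v hv => hs.backSubstitution_of_mem hv⟩
  induction v using eliminationKey_induction φ ψ with
  | ih v ih =>
    by_cases he : v ∈ eliminatedVars φ ψ a
    · rw [backSubstitution, if_pos he]
      refine totalDegree_bind₁_le_one (hs.affine v (Finset.mem_filter.1 he).1) fun w => ?_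
      split_ifs with hw
      · exact ih w hw
      · simp
    · rw [backSubstitution_of_notMem he, totalDegree_X]

/-- Downward from the largest key: the equation of an eliminated variable involves only variables
already known to agree. Since `l v` stays in `φ.vars`, the equations of the φ-side suffice. -/
theorem IsElimination.eval_eq (hσ : IsElimination φ ψ a l σ) (hs : IsSplitting φ ψ h a a₀ l)
    {x : Fin n → ℝ} (hx : ∀ v ∈ φ.vars, 0 < a v → x v = eval x (l v)) (v : Fin n)
    (hv : v ∈ φ.vars) : x v = eval x (σ v) := by
  revert hv
  induction v using eliminationKey_induction φ ψ with
  | ih v ih =>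
    intro hv
    by_cases he : v ∈ eliminatedVars φ ψ a
    · rw [hσ.solves v he, eval_bind₁_apply, hx v hv (Finset.mem_filter.1 he).2]
      refine eval_congr_vars fun w hw => ?_
      obtain ⟨h1, h2⟩ := hs.mem_of_mem_vars hv hw
      exact ih w h2 h1
    · rw [hσ.fixed v he, eval_X]

theorem IsElimination.holds_subst (hσ : IsElimination φ ψ a l σ)
    (hs : IsSplitting φ ψ h a a₀ l) {x : Fin n → ℝ} (hφ : φ.toFormula.Holds x)
    (hx : ∀ v ∈ φ.vars, 0 < a v → x v = eval x (l v)) : (φ.subst σ).toFormula.Holds x := by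
  rw [IneqSystem.holds_subst_iff]
  exact (IneqSystem.holds_congr fun v hv => hσ.eval_eq hs hx v hv).1 hφ

theorem IsElimination.vars_subst_subset (hσ : IsElimination φ ψ a l σ) :
    (φ.subst σ).vars ⊆ φ.vars \ eliminatedVars φ ψ a := by
  refine φ.vars_subst_subset fun v hv => ?_
  by_cases he : v ∈ eliminatedVars φ ψ a
  · exact hσ.vars_left v he hv
  · rw [hσ.fixed v he, vars_X, Finset.singleton_subset_iff]
    exact Finset.mem_sdiff.2 ⟨hv, he⟩

/-! ### Recursive calls -/

theorem IsSplitting.vars_add_subset (hs : IsSplitting φ ψ h a a₀ l) (δ : Fin φ.r → ℝ) :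
    (φ.combF δ + squarePart φ ψ a a₀ l).vars ⊆ φ.vars :=
  (MvPolynomial.vars_add_subset _ _).trans
    (Finset.union_subset (φ.vars_combF_subset δ) hs.vars_squarePart_subset)

theorem IsSplitting.eval_add_ge (hs : IsSplitting φ ψ h a a₀ l) {δ : Fin φ.r → ℝ}
    (hδ : ∀ i, 0 ≤ δ i) {x : Fin n → ℝ} (hx : φ.toFormula.Holds x) :
    a₀ / 2 ≤ eval x (φ.combF δ + squarePart φ ψ a a₀ l) := by
  rw [map_add]
  have h1 := IneqSystem.eval_combF_nonneg hx hδ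
  have h2 := hs.eval_squarePart_ge x
  linarith

theorem IsSplitting.eq_of_eval_add_eq_zero (hs : IsSplitting φ ψ h a a₀ l) {δ : Fin φ.r → ℝ}
    (hδ : ∀ i, 0 ≤ δ i) {x : Fin n → ℝ} (hx : φ.toFormula.Holds x)
    (h0 : eval x (φ.combF δ + squarePart φ ψ a a₀ l) = 0) :
    ∀ v ∈ φ.vars, 0 < a v → x v = eval x (l v) := by
  rw [map_add] at h0
  have h1 := IneqSystem.eval_combF_nonneg hx hδ
  have h2 := hs.eval_squarePart_ge x
  have h3 := hs.a₀_nonneg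
  exact fun v hv ha => hs.eq_of_eval_squarePart_eq_zero (by linarith) hv ha

/-- The symmetry behind the recursive step: whatever is proved of f over φ holds for -f over ψ. -/
theorem IsSplitting.neg_add_eq (hs : IsSplitting φ ψ h a a₀ l) {δ : Fin φ.r → ℝ}
    {δ' : Fin ψ.r → ℝ} (hid : φ.combF δ + ψ.combF δ' + h = 0) :
    -(φ.combF δ + squarePart φ ψ a a₀ l) = ψ.combF δ' + squarePart ψ φ a a₀ l := by
  rw [hs.eq_add] at hid
  rw [neg_eq_iff_add_eq_zero, ← hid]
  ring

theorem IsSplitting.eliminatedVars_nonempty (hs : IsSplitting φ ψ h a a₀ l) (h0 : a₀ = 0)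
    (hne : h ≠ 0) : (eliminatedVars φ ψ a).Nonempty := by
  by_contra hemp
  rw [Finset.not_nonempty_iff_eq_empty, eliminatedVars, Finset.filter_eq_empty_iff] at hemp
  have hz : ∀ v ∈ φ.vars ∪ ψ.vars, a v = 0 := fun v hv =>
    le_antisymm (not_lt.1 (hemp hv)) (hs.a_nonneg v hv)
  apply hne
  rw [hs.eq_add, squarePart_eq, squarePart_eq, h0,
    Finset.sum_eq_zero fun v hv => by simp [hz v (Finset.mem_union_left _ hv)],
    Finset.sum_eq_zero fun v hv => by simp [hz v (Finset.mem_union_right _ hv)]]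
  simp

/-- Beyond the claims on recursive calls, the last two clauses say that solutions with f = 0 survive
the substitution; soundness of the combined formula needs exactly this. -/
theorem RecursiveCall.spec {φ ψ φ' ψ' : IneqSystem n} {f : MvPolynomial (Fin n) ℝ}
    (hc : RecursiveCall φ ψ f φ' ψ') (hφ : φ.IsCQ) (hψ : ψ.IsCQ) (hcontra : φ.Contradictory ψ)
    (hv : ¬ φ.vars ⊆ ψ.vars) :
    f.vars ⊆ φ.vars ∩ ψ.vars ∧ φ.toFormula.Entails (.ge f) ∧ ψ.toFormula.Entails (.ge (-f)) ∧
    φ'.IsCQ ∧ ψ'.IsCQ ∧ φ'.Contradictory ψ' ∧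
    (φ'.vars ∪ ψ'.vars).card < (φ.vars ∪ ψ.vars).card ∧ φ'.vars ⊆ φ.vars ∧ ψ'.vars ⊆ ψ.vars ∧
    (∀ x, φ.toFormula.Holds x → eval x f = 0 → φ'.toFormula.Holds x) ∧
    ∀ x, ψ.toFormula.Holds x → eval x f = 0 → ψ'.toFormula.Holds x := by
  have hpos : 0 < (φ.vars ∪ ψ.vars).card := by
    rw [Finset.card_pos]
    by_contra hemp
    rw [Finset.not_nonempty_iff_eq_empty, Finset.union_eq_empty] at hemp
    exact hv (hemp.1 ▸ Finset.empty_subset _)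
  have general : ∀ {δ : Fin φ.r → ℝ} {δ' : Fin ψ.r → ℝ} {h a a₀ l},
      (∀ i, 0 ≤ δ i) → (∀ i, 0 ≤ δ' i) → φ.combF δ + ψ.combF δ' + h = 0 →
      IsSplitting φ ψ h a a₀ l →
      (φ.combF δ + squarePart φ ψ a a₀ l).vars ⊆ φ.vars ∩ ψ.vars ∧
      φ.toFormula.Entails (.ge (φ.combF δ + squarePart φ ψ a a₀ l)) ∧
      ψ.toFormula.Entails (.ge (-(φ.combF δ + squarePart φ ψ a a₀ l))) := by
    intro δ δ' h a a₀ l hδ hδ' hid hs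
    have h0 : 0 ≤ a₀ / 2 := div_nonneg hs.a₀_nonneg zero_le_two
    refine ⟨Finset.subset_inter (hs.vars_add_subset δ) ?_, fun x hx => ?_, fun x hx => ?_⟩
    · rw [← vars_neg, hs.neg_add_eq hid]
      exact hs.symm.vars_add_subset δ'
    · exact h0.trans (hs.eval_add_ge hδ hx)
    · rw [hs.neg_add_eq hid]
      exact h0.trans (hs.symm.eval_add_ge hδ' hx)
  cases hc with
  | inconsistent δ δ' h a a₀ l hδ hδ' hid _ hne hs ha₀ =>
    obtain ⟨h1, h2, h3⟩ := general hδ hδ' hid hs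
    refine ⟨h1, h2, h3, IneqSystem.isCQ_absurd n, IneqSystem.isCQ_absurd n,
      fun x hx => IneqSystem.not_holds_absurd x hx.1, ?_, ?_, ?_, fun x hx h0 => ?_,
      fun x hx h0 => ?_⟩
    · simpa [IneqSystem.vars_absurd] using hpos
    · simp [IneqSystem.vars_absurd]
    · simp [IneqSystem.vars_absurd]
    -- Here f ≥ a₀ / 2 > 0 on φ, so the case f = 0 is void.
    · have := hs.eval_add_ge hδ hx
      linarith
    · have := hs.symm.eval_add_ge hδ' hx
      rw [← hs.neg_add_eq hid, map_neg] at this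
      linarith
  | eliminate δ δ' h a a₀ l σ hδ hδ' hid _ hne hs ha₀ hσ =>
    obtain ⟨h1, h2, h3⟩ := general hδ hδ' hid hs
    have hφv := hσ.vars_subst_subset
    have hψv := hσ.symm.vars_subst_subset
    rw [eliminatedVars_comm] at hψv
    refine ⟨h1, h2, h3, hφ.subst hσ.affine, hψ.subst hσ.affine, hcontra.subst σ, ?_,
      hφv.trans Finset.sdiff_subset, hψv.trans Finset.sdiff_subset, fun x hx h0 => ?_,
      fun x hx h0 => ?_⟩
    · obtain ⟨v, hv⟩ := hs.eliminatedVars_nonempty ha₀ hne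
      refine Finset.card_lt_card ((Finset.ssubset_iff_of_subset (Finset.union_subset_union
        (hφv.trans Finset.sdiff_subset) (hψv.trans Finset.sdiff_subset))).2
        ⟨v, (Finset.mem_filter.1 hv).1, fun hmem => ?_⟩)
      rcases Finset.mem_union.1 hmem with h4 | h4
      · exact (Finset.mem_sdiff.1 (hφv h4)).2 hv
      · exact (Finset.mem_sdiff.1 (hψv h4)).2 hv
    · exact hσ.holds_subst hs hx (hs.eq_of_eval_add_eq_zero hδ hx h0)
    · refine hσ.symm.holds_subst hs.symm hx (hs.symm.eq_of_eval_add_eq_zero hδ' hx ?_)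
      rw [← hs.neg_add_eq hid, map_neg, h0, neg_zero]

/-- The given sum of squares is used only through its nonnegativity; its splitting is computed
afresh from the matrices of φ and ψ. -/
theorem exists_recursiveCall {φ ψ : IneqSystem n} (hφ : φ.IsCQ) (hψ : ψ.IsCQ)
    (hN : ¬ NSOSC φ ψ) : ∃ f φ' ψ', RecursiveCall φ ψ f φ' ψ' := by
  unfold NSOSC at hN
  push Not at hN
  obtain ⟨δ, δ', hδ, hδ', hsos, hne⟩ := hN
  obtain ⟨F, hF, -, hFc⟩ := hφ.exists_combF
  obtain ⟨F', hF', -, hFc'⟩ := hψ.exists_combF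
  obtain ⟨a, a₀, l, hs⟩ := exists_isSplitting_of_nonneg φ ψ
    (sum_smul_mem_concaveForms hδ hF) (sum_smul_mem_concaveForms hδ' hF')
    (fun x => by rw [← hFc, ← hFc']; exact eval_nonneg_of_isSumSq hsos x)
  rw [← hFc, ← hFc'] at hs
  have hid : φ.combF δ + ψ.combF δ' + -(φ.combF δ + ψ.combF δ') = 0 := add_neg_cancel _
  rcases hs.a₀_nonneg.eq_or_lt with h0 | h0
  · obtain ⟨σ, hσ⟩ := hs.exists_isElimination
    exact ⟨_, _, _, .eliminate δ δ' _ a a₀ l σ hδ hδ' hid hsos hne hs h0.symm hσ⟩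
  · exact ⟨_, _, _, .inconsistent δ δ' _ a a₀ l hδ hδ' hid hsos hne hs h0⟩

theorem RecursiveCall.isInterpolant {φ ψ φ' ψ' : IneqSystem n} {f : MvPolynomial (Fin n) ℝ}
    (hc : RecursiveCall φ ψ f φ' ψ') (hφ : φ.IsCQ) (hψ : ψ.IsCQ) (hcontra : φ.Contradictory ψ)
    (hv : ¬ φ.vars ⊆ ψ.vars) {I' : PolyFormula n}
    (hI : I'.IsInterpolant φ'.toFormula ψ'.toFormula) :
    (PolyFormula.or (.gt f) (.and (.ge f) I')).IsInterpolant φ.toFormula ψ.toFormula := by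
  obtain ⟨h1, h2, h3, -, -, -, -, h4, h5, h6, h7⟩ := hc.spec hφ hψ hcontra hv
  refine ⟨fun x hx => ?_, fun x hx => ?_, ?_⟩
  · have hge : 0 ≤ eval x f := h2 x hx
    rcases hge.eq_or_lt with h0 | h0
    · exact Or.inr ⟨hge, hI.1 x (h6 x hx h0.symm)⟩
    · exact Or.inl h0
  · have hle : 0 ≤ eval x (-f) := h3 x hx.2
    rw [map_neg] at hle
    rcases hx.1 with h0 | ⟨h0, h0'⟩
    · have h0 : 0 < eval x f := h0
      exact absurd h0 (by linarith)
    · have h0 : 0 ≤ eval x f := h0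
      exact hI.2.1 x ⟨h0', h7 x hx.2 (by linarith)⟩
  · exact Finset.union_subset h1 (Finset.union_subset h1
      (hI.2.2.trans (Finset.inter_subset_inter h4 h5)))

end Elimination

/-! ### Runs of the algorithm -/

section Runs

variable {n : ℕ}

/-- The result obtained from `I` by completing the pending calls. -/
def completePending (K : List (MvPolynomial (Fin n) ℝ)) (I : PolyFormula n) : PolyFormula n :=
  K.foldl (fun I f => .or (.gt f) (.and (.ge f) I)) I

/-- The invariant of the runs of IGFQC on `φ, ψ`. -/
def IGFQCInvariant (φ ψ : IneqSystem n) : IGFQCConfig n → Prop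
  | .call φ₁ ψ₁ K => φ₁.IsCQ ∧ ψ₁.IsCQ ∧ φ₁.Contradictory ψ₁ ∧
      (φ₁.vars ∪ ψ₁.vars).card + K.length ≤ (φ.vars ∪ ψ.vars).card ∧
      ∀ I : PolyFormula n, I.IsInterpolant φ₁.toFormula ψ₁.toFormula →
        (completePending K I).IsInterpolant φ.toFormula ψ.toFormula
  | .ret I K => (completePending K I).IsInterpolant φ.toFormula ψ.toFormula

/-- Each recursive call trades at least one variable for one stack entry, which keeps the size
bound. The last clause composes the local soundness statements along the stack. -/
theorem IGFQCStep.invariant {φ ψ : IneqSystem n} {c c' : IGFQCConfig n} (h : IGFQCStep c c')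
    (hc : IGFQCInvariant φ ψ c) : IGFQCInvariant φ ψ c' := by
  cases h with
  | varSubset φ₁ ψ₁ K hv =>
    obtain ⟨-, -, h3, -, h5⟩ := hc
    exact h5 _ ⟨fun _ hx => hx, h3, Finset.subset_inter (Finset.Subset.refl _) hv⟩
  | base φ₁ ψ₁ K I hv hN hI =>
    obtain ⟨-, -, -, -, h5⟩ := hc
    exact h5 _ hI.isInterpolant
  | recurse φ₁ ψ₁ φ₂ ψ₂ f K hv hN hr =>
    obtain ⟨h1, h2, h3, h4, h5⟩ := hc
    obtain ⟨-, -, -, g1, g2, g3, g4, -⟩ := hr.spec h1 h2 h3 hv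
    refine ⟨g1, g2, g3, ?_, fun I hI => h5 _ (hr.isInterpolant h1 h2 h3 hv hI)⟩
    rw [List.length_cons]
    omega
  -- Popping the stack is one step of the left fold, so the two sides agree by definition.
  | combine I' f K => exact hc

theorem IGFQCReaches.invariant {φ ψ : IneqSystem n} (hφ : φ.IsCQ) (hψ : ψ.IsCQ)
    (hcontra : φ.Contradictory ψ) {c : IGFQCConfig n} (h : IGFQCReaches φ ψ c) :
    IGFQCInvariant φ ψ c := by
  unfold IGFQCReaches at h
  induction h with
  | refl => exact ⟨hφ, hψ, hcontra, le_rfl, fun I hI => hI⟩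
  | tail _ hstep ih => exact hstep.invariant ih

theorem IGFQCInvariant.progress {φ ψ : IneqSystem n} {c : IGFQCConfig n}
    (h : IGFQCInvariant φ ψ c) : (∃ I, c = .ret I []) ∨ ∃ c', IGFQCStep c c' := by
  match c, h with
  | .ret I [], _ => exact Or.inl ⟨I, rfl⟩
  | .ret I (f :: K), _ => exact Or.inr ⟨_, .combine I f K⟩
  | .call φ₁ ψ₁ K, ⟨h1, h2, h3, _⟩ =>
    right
    by_cases hv : φ₁.vars ⊆ ψ₁.vars
    · exact ⟨_, .varSubset _ _ _ hv⟩
    · by_cases hN : NSOSC φ₁ ψ₁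
      · obtain ⟨I, hI⟩ := exists_IGFCHReturns h1 h2 h3 hN
        exact ⟨_, .base _ _ _ _ hv hN hI⟩
      · obtain ⟨f, φ', ψ', hc⟩ := exists_recursiveCall h1 h2 hN
        exact ⟨_, .recurse _ _ _ _ _ _ hv hN hc⟩

/-- A bound for the number of remaining steps. -/
noncomputable def IGFQCConfig.potential : IGFQCConfig n → ℕ
  | .call φ ψ K => 2 * (φ.vars ∪ ψ.vars).card + 1 + K.length
  | .ret _ K => K.length

/-- A recursive call lowers twice the variable count by at least 2 and lengthens the stack by 1. The
extra 1 in a call pays for the return from a base case. -/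
theorem IGFQCStep.potential_lt {φ ψ : IneqSystem n} {c c' : IGFQCConfig n} (h : IGFQCStep c c')
    (hc : IGFQCInvariant φ ψ c) : c'.potential < c.potential := by
  cases h with
  | varSubset φ₁ ψ₁ K hv => simp only [IGFQCConfig.potential]; omega
  | base φ₁ ψ₁ K I hv hN hI => simp only [IGFQCConfig.potential]; omega
  | recurse φ₁ ψ₁ φ₂ ψ₂ f K hv hN hr =>
    obtain ⟨h1, h2, h3, -⟩ := hc
    obtain ⟨-, -, -, -, -, -, g4, -⟩ := hr.spec h1 h2 h3 hv
    simp only [IGFQCConfig.potential, List.length_cons]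
    omega
  | combine I' f K => simp [IGFQCConfig.potential]

theorem IGFQCInvariant.exists_ret {φ ψ : IneqSystem n} {c : IGFQCConfig n}
    (h : IGFQCInvariant φ ψ c) : ∃ I, Relation.ReflTransGen IGFQCStep c (.ret I []) := by
  induction hp : c.potential using Nat.strong_induction_on generalizing c with
  | _ k ih =>
    rcases h.progress with ⟨I, rfl⟩ | ⟨c', hc'⟩
    · exact ⟨I, .refl⟩
    · obtain ⟨I, hI⟩ := ih _ (hp ▸ hc'.potential_lt h) (hc'.invariant h) rfl
      exact ⟨I, .head hc' hI⟩

theorem IGFQCInvariant.length_le {φ ψ : IneqSystem n} {N : ℕ} {c : ℕ → IGFQCConfig n}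
    (h : IGFQCInvariant φ ψ (c 0)) (hc : ∀ i < N, IGFQCStep (c i) (c (i + 1))) :
    N ≤ (c 0).potential := by
  have key : ∀ i ≤ N, IGFQCInvariant φ ψ (c i) ∧ (c i).potential + i ≤ (c 0).potential := by
    intro i
    induction i with
    | zero => exact fun _ => ⟨h, le_rfl⟩
    | succ i ih =>
      intro hi
      obtain ⟨h1, h2⟩ := ih (by omega)
      have hstep := hc i (by omega)
      have := hstep.potential_lt h1
      exact ⟨hstep.invariant h1, by omega⟩
  have := (key N le_rfl).2
  omega

end Runs

theorem mainTheorem3 (n : ℕ) (φ ψ : IneqSystem n) (hφ : φ.IsCQ) (hψ : ψ.IsCQ)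
    (hcontra : φ.Contradictory ψ) :
    -- soundness: every output is an interpolant
    (∀ I, IGFQCReturns φ ψ I → I.IsInterpolant φ.toFormula ψ.toFormula) ∧
    -- completeness: there is an output, and no run gets stuck before producing one
    (∃ I, IGFQCReturns φ ψ I) ∧
    (∀ c, IGFQCReaches φ ψ c → (∃ I, c = .ret I []) ∨ ∃ c', IGFQCStep c c') ∧
    -- termination: runs are finite, with at most one recursive call per variable
    (∀ (N : ℕ) (c : ℕ → IGFQCConfig n), c 0 = .call φ ψ [] →
      (∀ i < N, IGFQCStep (c i) (c (i + 1))) → N ≤ 2 * (φ.vars ∪ ψ.vars).card + 1) ∧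
    (∀ φ₁ ψ₁ K, IGFQCReaches φ ψ (.call φ₁ ψ₁ K) → K.length ≤ (φ.vars ∪ ψ.vars).card) ∧
    -- every recursive call made in a run
    (∀ φ₁ ψ₁ K φ₂ ψ₂ f, IGFQCReaches φ ψ (.call φ₁ ψ₁ K) →
      IGFQCStep (.call φ₁ ψ₁ K) (.call φ₂ ψ₂ (f :: K)) →
        ¬ NSOSC φ₁ ψ₁ ∧
        f.vars ⊆ φ₁.vars ∩ ψ₁.vars ∧
        φ₁.toFormula.Entails (.ge f) ∧ ψ₁.toFormula.Entails (.ge (-f)) ∧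
        φ₂.IsCQ ∧ ψ₂.IsCQ ∧ φ₂.Contradictory ψ₂ ∧
        (φ₂.vars ∪ ψ₂.vars).card < (φ₁.vars ∪ ψ₁.vars).card) := by
  have hinit : IGFQCInvariant φ ψ (.call φ ψ []) :=
    ⟨hφ, hψ, hcontra, le_rfl, fun I hI => hI⟩
  refine ⟨fun I hI => IGFQCReaches.invariant hφ hψ hcontra hI, hinit.exists_ret,
    fun c hc => (hc.invariant hφ hψ hcontra).progress, fun N c h0 hc => ?_,
    fun φ₁ ψ₁ K h => ?_, fun φ₁ ψ₁ K φ₂ ψ₂ f h hstep => ?_⟩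
  · exact (h0 ▸ hinit : IGFQCInvariant φ ψ (c 0)).length_le hc |>.trans (by
      rw [h0, IGFQCConfig.potential, List.length_nil, add_zero])
  · obtain ⟨-, -, -, h4, -⟩ := h.invariant hφ hψ hcontra
    omega
  · obtain ⟨h1, h2, h3, -⟩ := h.invariant hφ hψ hcontra
    cases hstep with
    | recurse _ _ _ _ _ _ hv hN hr =>
      obtain ⟨g1, g2, g3, g4, g5, g6, g7, -⟩ := hr.spec h1 h2 h3 hv
      exact ⟨hN, g1, g2, g3, g4, g5, g6, g7⟩
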